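/- Notation. Let $\ell_0$ be the set of finitely supported sequences $\mathbb{Z}\to\mathbb{C}$, and let $\delta(0)=1$, $\delta(k)=0$ for $k\neq 0$. For an integer $D\ge 2$, $a\in\ell_0$ and $v:\mathbb{Z}\to\mathbb{C}$ put $[S_{a,D}v](j)=D\sum_{k\in\mathbb{Z}}v(k)\,a(j-Dk)$, $[\nabla v](k)=v(k)-v(k-1)$, and $[u*v](j)=\sum_{k\in\mathbb{Z}} u(k)v(j-k)$ for $u,v\in\ell_0$. For $a\in\ell_0$ with $\sum_k a(k)=1$ let $\mathrm{sr}(a,D)$ be the largest integer $J\ge 0$ such that, for some $b\in\ell_0$, $\sum_k a(k)z^k=(1+z+\cdots+z^{D-1})^J\sum_k b(k)z^k$ for all $z\in\mathbb{C}\setminus\{0\}$, and let $$\mathrm{sm}_\infty(a,D)=-\log_D\limsup_{n\to\infty}\|\nabla^{J}S_{a,D}^n\delta\|_{\ell_\infty}^{1/n},\qquad J=\mathrm{sr}(a,D).$$ Let $M\ge 2$, $r\ge 1$ and $m\ge 0$ be integers and let $a_1,\dots,a_r\in\ell_0$ satisfy $\sum_k a_\ell(k)=1$ for all $\ell$. Let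 $S^{n,r}$ be the composition of the first $n$ operators, in order of application, of the $r$-periodic list $S_{a_1,M},\dots,S_{a_r,M},S_{a_1,M},\dots,S_{a_r,M},\dots$. The quasi-stationary $M$-subdivision scheme with masks $\{a_1,\dots,a_r\}$ is $C^m$-convergent if for every $v:\mathbb{Z}\to\mathbb{C}$ there is a function $\eta_v\in C^m(\mathbb{R})$ such that, for all $K>0$ and $j=0,\dots,m$, $$\lim_{n\to\infty}\ \max_{k\in\mathbb{Z}\cap[-M^nK,M^nK]}\bigl|M^{jn}[\nabla^jS^{n,r}v](k)-\eta_v^{(j)}(M^{-n}k)\bigr|=0 .$$ A $C^m$-convergent scheme is $\infty$-step interpolatory at $s_a\in\mathbb{R}$ if $\eta_v(s_a+k)=v(k)$ for all $k\in\mathbb{Z}$ and all $v:\mathbb{Z}\to\mathbb{C}$. Put $a=M^{-r}S_{a_r,M}\cdots S_{a_1,M}\delta$ and $A_n=M^{-rn}S_{a,M^r}^n\delta$ for $n\ge 0$. Corollary 4.1. Let $s_a\in\mathbb{R}$ and let $m_s\ge 0$, $n_s\ge 1$ be integers with $M^{rm_s}(M^{rn_s}-1)s_a\in\mathbb{Z}$.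 Then the quasi-stationary $M$-subdivision scheme with masks $\{a_1,\dots,a_r\}$ is $C^m$-convergent and $\infty$-step interpolatory at $s_a$ if and only if both of the following hold: (i) $\mathrm{sm}_\infty(a,M^r)>m$ and $\mathrm{sr}(a_\ell,M)>m$ for all $\ell=1,\dots,r$; (ii) there is $w\in\ell_0$ such that, for all $k\in\mathbb{Z}$, $$[A_{m_s}*w](M^{rm_s}k)=M^{-rm_s}\delta(k),\qquad [A_{n_s}*w]\bigl(M^{rm_s}(M^{rn_s}-1)s_a+M^{rn_s}k\bigr)=M^{-rn_s}w(k).$$ If $m_s=0$, then (ii) is equivalent to $A_{n_s}\bigl((M^{rn_s}-1)s_a+M^{rn_s}k\bigr)=M^{-rn_s}\delta(k)$ for all $k\in\mathbb{Z}$. Moreover, if $m_s=0$ and the scheme is $C^m$-convergent and $\infty$-step interpolatory at $s_a$, then it is $rn_s$-step interpolatory with the integer shift $(M^{rn_s}-1)s_a$: for all integers $q\ge 1$, all $k\in\mathbb{Z}$ and all $v:\mathbb{Z}\to\mathbb{C}$, $$[S^{qrn_s,r}v]\bigl((1+M^{rn_s}+\cdots+M^{(q-1)rn_s})(M^{rn_s}-1)s_a+M^{qrn_s}k\bigr)=v(k).$$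 -/

import Mathlib

open Filter Topology

noncomputable section

/-- The Dirac sequence `δ` on `ℤ`: `δ 0 = 1` and `δ k = 0` for `k ≠ 0`. -/
def diracSeq : ℤ → ℂ := fun k => if k = 0 then 1 else 0

/-- The `M`-subdivision operator
`[S_{a,M} v](j) = M ∑_{k ∈ ℤ} v(k) a(j - M k)`, acting on all sequences `v : ℤ → ℂ`.
For a finitely supported mask `a` and `M ≠ 0` only finitely many terms are nonzero. -/
def subdivOp (M : ℕ) (a v : ℤ → ℂ) : ℤ → ℂ :=
  fun j => (M : ℂ) * ∑ᶠ k : ℤ, v k * a (j - (M : ℤ) * k)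

/-- The backward difference operator `[∇ v](k) = v(k) - v(k - 1)`. -/
def backwardDiff (v : ℤ → ℂ) : ℤ → ℂ := fun k => v k - v (k - 1)

/-- Convolution `[u * v](j) = ∑_{k ∈ ℤ} u(k) v(j - k)` (used for finitely supported `u`, `v`). -/
def seqConv (u v : ℤ → ℂ) : ℤ → ℂ := fun j => ∑ᶠ k : ℤ, u k * v (j - k)

/-- The symbol `∑_{k ∈ ℤ} a(k) z ^ k` of a finitely supported sequence, for `z ≠ 0`. -/
def maskSymbol (a : ℤ → ℂ) (z : ℂ) : ℂ := ∑ᶠ k : ℤ, a k * z ^ k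

/-- `a` has order `J` sum rules with respect to the dilation factor `M`: its symbol is
`(1 + z + ⋯ + z ^ (M - 1)) ^ J` times the symbol of a finitely supported sequence `b`. -/
def HasSumRules (M : ℕ) (a : ℤ → ℂ) (J : ℕ) : Prop :=
  ∃ b : ℤ → ℂ, (Function.support b).Finite ∧
    ∀ z : ℂ, z ≠ 0 →
      maskSymbol a z = (∑ i ∈ Finset.range M, z ^ i) ^ J * maskSymbol b z

/-- `sr(a, M)`: the largest `J` such that `a` has order `J` sum rules with respect to `M`.
(For a finitely supported `a ≠ 0` and `M ≥ 2` the set of such `J` is finite and contains `0`.) -/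
def sumRuleOrder (M : ℕ) (a : ℤ → ℂ) : ℕ := sSup {J : ℕ | HasSumRules M a J}

/-- `ρ_J(a, M)_∞ = limsup_{n → ∞} ‖∇^J S_{a,M}^n δ‖_{ℓ^∞} ^ (1 / n)`. -/
def rhoInfty (M : ℕ) (a : ℤ → ℂ) (J : ℕ) : ℝ :=
  limsup
    (fun n : ℕ => (⨆ k : ℤ, ‖(backwardDiff^[J] ((subdivOp M a)^[n] diracSeq)) k‖) ^ (1 / (n : ℝ)))
    atTop

/-- `sm_∞(a, M) = - log_M ρ_J(a, M)_∞` with `J = sr(a, M)`.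
(If `a` is finitely supported with `∑ a = 1` and `M ≥ 2`, then the limsup is that of a bounded
sequence and is at least `M ^ (-J) > 0`, so this is an honest real number.) -/
def smInfty (M : ℕ) (a : ℤ → ℂ) : ℝ :=
  - Real.logb (M : ℝ) (rhoInfty M a (sumRuleOrder M a))

/-- The masks `A_n = D ^ (-n) S_{a,D}^n δ` of a mask `a` with respect to the dilation factor `D`. -/
def iterMask (D : ℕ) (a : ℤ → ℂ) (n : ℕ) : ℤ → ℂ :=
  fun k => ((D : ℂ) ^ n)⁻¹ * ((subdivOp D a)^[n] diracSeq) k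

/-- The `n`-step operator of the `r`-periodic quasi-stationary scheme: the first `n` of the
operators `S_{a_1,M}, …, S_{a_r,M}, S_{a_1,M}, …, S_{a_r,M}, …` are applied, in this order.
The masks are indexed by `Fin r`, so `a_1, …, a_r` are `a 0, …, a (r - 1)`, and the `(n + 1)`-st
operator uses the mask with index `n mod r`. -/
def quasiSubdiv (M : ℕ) {r : ℕ} [NeZero r] (a : Fin r → ℤ → ℂ) : ℕ → (ℤ → ℂ) → (ℤ → ℂ)
  | 0, v => v
  | n + 1, v => subdivOp M (a (Fin.ofNat r n)) (quasiSubdiv M a n v)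

/-- The mask `a = M ^ (-r) S_{a_r,M} ⋯ S_{a_1,M} δ`. -/
def compositeMask (M : ℕ) {r : ℕ} [NeZero r] (a : Fin r → ℤ → ℂ) : ℤ → ℂ :=
  fun k => ((M : ℂ) ^ r)⁻¹ * quasiSubdiv M a r diracSeq k

/-- `η` is a `C^m` limit function of the quasi-stationary `M`-subdivision scheme with initial data
`v`: `η ∈ C^m(ℝ)` and, for all `K > 0` and `0 ≤ j ≤ m`, the maximum over the integers
`k ∈ [-M^n K, M^n K]` of `|M^{jn} [∇^j S^{n,r} v](k) - η^{(j)}(M^{-n} k)|` tends to `0`. -/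
def IsQSLimit (M : ℕ) {r : ℕ} [NeZero r] (a : Fin r → ℤ → ℂ) (m : ℕ)
    (v : ℤ → ℂ) (η : ℝ → ℂ) : Prop :=
  ContDiff ℝ m η ∧
    ∀ K : ℝ, 0 < K → ∀ j : ℕ, j ≤ m → ∀ ε : ℝ, 0 < ε →
      ∀ᶠ n : ℕ in atTop, ∀ k : ℤ, |(k : ℝ)| ≤ (M : ℝ) ^ n * K →
        ‖(M : ℂ) ^ (j * n) * (backwardDiff^[j] (quasiSubdiv M a n v)) k
          - iteratedDeriv j η ((k : ℝ) / (M : ℝ) ^ n)‖ < ε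

/-- The quasi-stationary `M`-subdivision scheme with masks `a` is `C^m`-convergent. -/
def QSConvergent (M : ℕ) {r : ℕ} [NeZero r] (a : Fin r → ℤ → ℂ) (m : ℕ) : Prop :=
  ∀ v : ℤ → ℂ, ∃ η : ℝ → ℂ, IsQSLimit M a m v η

/-- The limit functions `η_v` of the scheme interpolate the data at `s + ℤ`:
`η_v(s + k) = v(k)` for all `k ∈ ℤ` and all sequences `v`. -/
def QSInftyStepInterpolatory (M : ℕ) {r : ℕ} [NeZero r] (a : Fin r → ℤ → ℂ) (m : ℕ)
    (s : ℝ) : Prop :=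
  ∀ (v : ℤ → ℂ) (η : ℝ → ℂ), IsQSLimit M a m v η → ∀ k : ℤ, η (s + k) = v k

/-- The coset conditions on `w` for the masks `A_n` of `a` with respect to `D`, with shift `c`:
`[A_p * w](D^p k) = D^{-p} δ(k)` and `[A_n * w](c + D^n k) = D^{-n} w(k)` for all `k ∈ ℤ`. -/
def CosetConditions (D : ℕ) (a : ℤ → ℂ) (p n : ℕ) (c : ℤ) (w : ℤ → ℂ) : Prop :=
  (∀ k : ℤ, seqConv (iterMask D a p) w ((D : ℤ) ^ p * k) = ((D : ℂ) ^ p)⁻¹ * diracSeq k) ∧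
  (∀ k : ℤ, seqConv (iterMask D a n) w (c + (D : ℤ) ^ n * k) = ((D : ℂ) ^ n)⁻¹ * w k)

end

/-!
The proof first characterizes `C^m`-convergence, and then reads off interpolation from the basic
limit function `φ`, the limit for the initial data `δ`. Write `D = M ^ r` and let `S` be the
subdivision operator of the composite mask with respect to `D`, so that `S^n` is `r n` steps of the
quasi-stationary scheme.

*Convergence* (`qsConvergent_iff`). A factor `(1 + z + ⋯ + z ^ (M - 1)) ^ J` of the masks lets `∇^J`
pass through the subdivision operators and turns the masks `a_ℓ` into masks `b_ℓ`
(`backwardDiff_iterate_subdivSeq`). If `∇^{m+1} S^n δ` decays like `θ ^ n` with `θ < D ^ (-m)`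
(`GeometricDecay`), then the scaled differences `M ^ (j n) ∇^j S^{n,r} δ` with `j ≤ m` converge
uniformly at a geometric rate to continuous functions, and each of these is the derivative of the
previous one (`exists_dyadicLimit`, `hasDerivAt_of_dyadicLimit`). The hypothesis `sm_∞ > m` is such
a decay for differences of order `sr`; it descends to order `m + 1` by `GeometricDecay.of_succ`.
Conversely, if the scheme converges, then no derivative `φ^{(j)}`, `j ≤ m`, vanishes identically,
and comparison of two consecutive steps near a point where it does not vanish gives one more sum
rule (`IsQSLimit.exists_eq_boxSum_succ`). Moreover `D ^ (m n) ∇^{m+1} S^n δ` tends to `0` uniformly.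
This improves to geometric decay because the operator norms of `S_b^n` are controlled by
`S_b^n ∇^{m+1} δ` alone (`exists_norm_subdivSeq_le`), and operator norms are submultiplicative.

*Interpolation*. All limit functions are superpositions of integer translates of `φ`
(`IsQSLimit.eq_finsum`), so that interpolation at `s + ℤ` means `φ(s + k) = δ(k)`. The function `φ`
satisfies the refinement equation `φ(x) = ∑ (S^n δ)(k) φ(D^n x - k)` and its integer translates sum
to `1`. With `t = D ^ m_s s`, so that `D ^ n_s t = t + c`, the refinement equation says that the
samples `w(k) = φ(t + k)` satisfy the coset conditions (`IsQSLimit.cosetConditions`). Conversely,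
iteration of the second condition expresses `w(k)` by values of `S^{q n_s} δ` at points which
approach `t + k - l` on the scale `D ^ (-q n_s)`; as `q → ∞` this forces `w(k) = φ(t + k) ∑ w`, and
the first condition becomes `(∑ w) φ(s + k) = δ(k)`; summation over `k` gives `∑ w = 1`
(`IsQSLimit.eq_diracSeq_of_cosetConditions`).
-/

/-! ### Subdivision operators and their iterates -/

/-- `n` steps of the subdivision process which uses the mask `α i` at step `i`. -/
noncomputable def subdivSeq (M : ℕ) (α : ℕ → ℤ → ℂ) : ℕ → (ℤ → ℂ) → (ℤ → ℂ)
  | 0, v => v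
  | n + 1, v => subdivOp M (α n) (subdivSeq M α n v)

/-- Convolution with `1 + z + ⋯ + z ^ (M - 1)`, the factor in the sum rules. -/
noncomputable def boxSum (M : ℕ) (b : ℤ → ℂ) : ℤ → ℂ := fun k => ∑ i ∈ Finset.range M, b (k - i)

/-- `f` vanishes outside `[-L, L]`. -/
def SupportedIn (L : ℤ) (f : ℤ → ℂ) : Prop := ∀ k, L < |k| → f k = 0

lemma SupportedIn.mono {L L' : ℤ} {f : ℤ → ℂ} (h : SupportedIn L f) (hL : L ≤ L') :
    SupportedIn L' f := fun k hk => h k (hL.trans_lt hk)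

lemma SupportedIn.finite {L : ℤ} {f : ℤ → ℂ} (h : SupportedIn L f) :
    (Function.support f).Finite := by
  refine (Set.finite_Icc (-L) L).subset fun k hk => ?_
  by_contra hk'
  refine hk (h k ?_)
  simp only [Set.mem_Icc, ← abs_le] at hk'
  exact not_le.1 hk'

lemma exists_supportedIn {f : ℤ → ℂ} (h : (Function.support f).Finite) :
    ∃ L : ℤ, 0 ≤ L ∧ SupportedIn L f := by
  obtain ⟨L, hL⟩ := (h.image (fun k : ℤ => |k|)).bddAbove
  refine ⟨max L 0, le_max_right _ _, fun k hk => ?_⟩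
  by_contra hne
  have := hL (Set.mem_image_of_mem _ (show k ∈ Function.support f from hne))
  simp only [max_lt_iff] at hk
  omega

lemma supportedIn_diracSeq : SupportedIn 0 diracSeq := by
  intro k hk
  simp [diracSeq, abs_pos.1 hk]

lemma finite_support_subdiv {M : ℕ} (hM : M ≠ 0) {a : ℤ → ℂ}
    (ha : (Function.support a).Finite) (v : ℤ → ℂ) (j : ℤ) :
    (Function.support fun k : ℤ => v k * a (j - (M : ℤ) * k)).Finite := by
  refine (ha.preimage (f := fun k : ℤ => j - (M : ℤ) * k) ?_).subset ?_
  · intro x _ y _ hxy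
    exact mul_left_cancel₀ (Nat.cast_ne_zero.2 hM : (M : ℤ) ≠ 0) (by linarith)
  · intro k hk
    exact right_ne_zero_of_mul hk

/-- The change of variables `k ↦ k + l` in the sum defining the subdivision operator. -/
lemma finsum_subdiv_shift (M : ℕ) (a v : ℤ → ℂ) (j l : ℤ) :
    ∑ᶠ k : ℤ, v (k - l) * a (j - (M : ℤ) * k) =
      ∑ᶠ k : ℤ, v k * a (j - (M : ℤ) * l - (M : ℤ) * k) := by
  rw [← finsum_comp_equiv (Equiv.addRight l)]
  refine finsum_congr fun k => ?_
  simp only [Equiv.coe_addRight, add_sub_cancel_right]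
  congr 2
  ring

lemma subdivOp_shift (M : ℕ) (a v : ℤ → ℂ) (j l : ℤ) :
    subdivOp M a (fun k => v (k - l)) j = subdivOp M a v (j - (M : ℤ) * l) := by
  simp only [subdivOp, finsum_subdiv_shift]

lemma finite_support_shift {b : ℤ → ℂ} (hb : (Function.support b).Finite) (i : ℤ) :
    (Function.support fun k => b (k - i)).Finite := by
  refine (hb.preimage (f := fun k : ℤ => k - i) ?_).subset fun k hk => hk
  intro x _ y _ hxy
  simpa using hxy

lemma finite_support_boxSum (M : ℕ) {b : ℤ → ℂ} (hb : (Function.support b).Finite) :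
    (Function.support (boxSum M b)).Finite := by
  have h : (⋃ i ∈ Finset.range M, Function.support fun k => b (k - (i : ℤ))).Finite :=
    (Finset.range M).finite_toSet.biUnion fun i _ => finite_support_shift hb i
  refine h.subset fun k hk => ?_
  obtain ⟨i, hi, hne⟩ := Finset.exists_ne_zero_of_sum_ne_zero hk
  exact Set.mem_biUnion hi hne

lemma finite_support_boxSum_iterate (M J : ℕ) {b : ℤ → ℂ} (hb : (Function.support b).Finite) :
    (Function.support ((boxSum M)^[J] b)).Finite := by
  induction J with
  | zero => exact hb
  | succ J ih => rw [Function.iterate_succ_apply']; exact finite_support_boxSum M ih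

/-- Telescoping: `(1 - z) (1 + ⋯ + z ^ (M - 1)) = 1 - z ^ M`. -/
lemma backwardDiff_boxSum (M : ℕ) (b : ℤ → ℂ) (k : ℤ) :
    backwardDiff (boxSum M b) k = b k - b (k - M) := by
  simp only [backwardDiff, boxSum]
  rw [← Finset.sum_sub_distrib]
  have h := Finset.sum_range_sub' (fun i : ℕ => b (k - i)) M
  simp only [Nat.cast_zero, sub_zero] at h
  rw [← h]
  refine Finset.sum_congr rfl fun i _ => ?_
  congr 2
  push_cast
  ring

/-- A factor `1 + z + ⋯ + z ^ (M - 1)` of the mask lets the difference operator pass through the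
subdivision operator. -/
lemma backwardDiff_subdivOp {M : ℕ} (hM : M ≠ 0) {b : ℤ → ℂ}
    (hb : (Function.support b).Finite) (v : ℤ → ℂ) :
    backwardDiff (subdivOp M (boxSum M b) v) = subdivOp M b (backwardDiff v) := by
  funext j
  have h1 := finite_support_subdiv hM (finite_support_boxSum M hb) v
  have h2 := finite_support_subdiv hM hb v
  have h3 := finite_support_subdiv hM hb fun k => v (k - 1)
  have e : ∀ k : ℤ, v k * boxSum M b (j - (M : ℤ) * k) - v k * boxSum M b (j - 1 - (M : ℤ) * k)
      = v k * b (j - (M : ℤ) * k) - v k * b (j - (M : ℤ) * 1 - (M : ℤ) * k) := by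
    intro k
    have := backwardDiff_boxSum M b (j - (M : ℤ) * k)
    rw [backwardDiff, show j - (M : ℤ) * k - 1 = j - 1 - (M : ℤ) * k by ring,
      show j - (M : ℤ) * k - M = j - (M : ℤ) * 1 - (M : ℤ) * k by ring] at this
    rw [← mul_sub, ← mul_sub, this]
  have e2 : ∀ k : ℤ, (v k - v (k - 1)) * b (j - (M : ℤ) * k)
      = v k * b (j - (M : ℤ) * k) - v (k - 1) * b (j - (M : ℤ) * k) := fun k => sub_mul _ _ _
  simp only [backwardDiff, subdivOp]
  rw [← mul_sub, ← finsum_sub_distrib (h1 j) (h1 (j - 1)), finsum_congr e, finsum_congr e2,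
    finsum_sub_distrib (h2 j) (h2 _), finsum_sub_distrib (h2 j) (h3 j), finsum_subdiv_shift]

lemma backwardDiff_iterate_subdivOp {M : ℕ} (hM : M ≠ 0) {b : ℤ → ℂ}
    (hb : (Function.support b).Finite) (J : ℕ) (v : ℤ → ℂ) :
    backwardDiff^[J] (subdivOp M ((boxSum M)^[J] b) v) = subdivOp M b (backwardDiff^[J] v) := by
  induction J generalizing v with
  | zero => rfl
  | succ J ih =>
    rw [Function.iterate_succ_apply, Function.iterate_succ_apply' (boxSum M),
      backwardDiff_subdivOp hM (finite_support_boxSum_iterate M J hb), ih,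
      ← Function.iterate_succ_apply]

lemma backwardDiff_iterate_subdivSeq {M : ℕ} (hM : M ≠ 0) {b : ℕ → ℤ → ℂ}
    (hb : ∀ n, (Function.support (b n)).Finite) (J n : ℕ) (v : ℤ → ℂ) :
    backwardDiff^[J] (subdivSeq M (fun i => (boxSum M)^[J] (b i)) n v) =
      subdivSeq M b n (backwardDiff^[J] v) := by
  induction n with
  | zero => rfl
  | succ n ih => simp only [subdivSeq]; rw [backwardDiff_iterate_subdivOp hM (hb n), ih]

lemma subdivOp_eq_sum {M : ℕ} (hM : M ≠ 0) {a : ℤ → ℂ} (ha : (Function.support a).Finite)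
    (j : ℤ) : ∃ s : Finset ℤ, ∀ v : ℤ → ℂ,
      subdivOp M a v j = (M : ℂ) * ∑ k ∈ s, v k * a (j - (M : ℤ) * k) := by
  refine ⟨(finite_support_subdiv hM ha (fun _ => 1) j).toFinset, fun v => ?_⟩
  rw [subdivOp, finsum_eq_sum_of_support_subset]
  intro k hk
  simpa using right_ne_zero_of_mul hk

lemma subdivOp_support {M : ℕ} (hM : 2 ≤ M) {L K : ℤ} {a v : ℤ → ℂ} (ha : SupportedIn L a)
    (hv : SupportedIn K v) : SupportedIn ((M : ℤ) * K + L) (subdivOp M a v) := by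
  intro j hj
  rw [subdivOp, finsum_eq_zero_of_forall_eq_zero, mul_zero]
  intro k
  by_cases hk : K < |k|
  · rw [hv k hk, zero_mul]
  · rw [ha (j - (M : ℤ) * k), mul_zero]
    have h1 : (M : ℤ) * |k| ≤ M * K := mul_le_mul_of_nonneg_left (not_lt.1 hk) (by positivity)
    have h2 : |j| ≤ |j - (M : ℤ) * k| + |(M : ℤ) * k| := by
      simpa using abs_add_le (j - (M : ℤ) * k) ((M : ℤ) * k)
    rw [abs_mul, Nat.abs_cast] at h2
    linarith

lemma subdivSeq_support {M : ℕ} (hM : 2 ≤ M) {L K : ℤ} (hL : 0 ≤ L) {α : ℕ → ℤ → ℂ}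
    (hα : ∀ n, SupportedIn L (α n)) {v : ℤ → ℂ} (hv : SupportedIn K v) (n : ℕ) :
    SupportedIn ((K + L) * (M : ℤ) ^ n) (subdivSeq M α n v) := by
  have key : SupportedIn ((K + L) * (M : ℤ) ^ n - L) (subdivSeq M α n v) := by
    induction n with
    | zero => exact hv.mono (by simp)
    | succ n ih =>
      refine (subdivOp_support hM (hα n) ih).mono ?_
      rw [pow_succ]
      nlinarith
  exact key.mono (by linarith)

lemma finite_support_subdivOp {M : ℕ} (hM : 2 ≤ M) {a v : ℤ → ℂ}
    (ha : (Function.support a).Finite) (hv : (Function.support v).Finite) :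
    (Function.support (subdivOp M a v)).Finite := by
  obtain ⟨L, -, hL⟩ := exists_supportedIn ha
  obtain ⟨K, -, hK⟩ := exists_supportedIn hv
  exact (subdivOp_support hM hL hK).finite

lemma finite_support_subdivSeq {M : ℕ} (hM : 2 ≤ M) {α : ℕ → ℤ → ℂ}
    (hα : ∀ n, (Function.support (α n)).Finite) {v : ℤ → ℂ} (hv : (Function.support v).Finite)
    (n : ℕ) : (Function.support (subdivSeq M α n v)).Finite := by
  induction n with
  | zero => exact hv
  | succ n ih => exact finite_support_subdivOp hM (hα n) ih

lemma finite_support_dilate {M : ℕ} (hM : M ≠ 0) {f : ℤ → ℂ} (hf : (Function.support f).Finite)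
    (n : ℕ) (v : ℤ → ℂ) (j : ℤ) :
    (Function.support fun l : ℤ => v l * f (j - (M : ℤ) ^ n * l)).Finite := by
  simpa using finite_support_subdiv (M := M ^ n) (pow_ne_zero n hM) hf v j

/-- The subdivision process is determined by its values on the Dirac sequence. -/
lemma subdivSeq_eq_finsum {M : ℕ} (hM : 2 ≤ M) {α : ℕ → ℤ → ℂ}
    (hα : ∀ n, (Function.support (α n)).Finite) (n : ℕ) (v : ℤ → ℂ) (j : ℤ) :
    subdivSeq M α n v j = ∑ᶠ l : ℤ, v l * subdivSeq M α n diracSeq (j - (M : ℤ) ^ n * l) := by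
  have hM0 : M ≠ 0 := by omega
  induction n generalizing j with
  | zero =>
    rw [finsum_eq_single _ j]
    · simp [subdivSeq, diracSeq]
    · intro l hl
      have : j - l ≠ 0 := fun h => hl (by omega)
      simp [subdivSeq, diracSeq, this]
  | succ n ih =>
    have hfin := finite_support_subdivSeq hM hα supportedIn_diracSeq.finite n
    obtain ⟨s, hs⟩ := subdivOp_eq_sum hM0 (hα n) j
    have e : ∀ l : ℤ, v l * subdivSeq M α (n + 1) diracSeq (j - (M : ℤ) ^ (n + 1) * l) =
        ∑ k ∈ s, (M : ℂ) * (v l * subdivSeq M α n diracSeq (k - (M : ℤ) ^ n * l)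
          * α n (j - (M : ℤ) * k)) := by
      intro l
      have := subdivOp_shift M (α n) (subdivSeq M α n diracSeq) j ((M : ℤ) ^ n * l)
      rw [hs, ← mul_assoc, ← pow_succ'] at this
      simp only [subdivSeq]
      rw [← this, Finset.mul_sum, Finset.mul_sum]
      exact Finset.sum_congr rfl fun k _ => by ring
    have hk : ∀ k : ℤ, (Function.support fun l : ℤ => (M : ℂ) *
        (v l * subdivSeq M α n diracSeq (k - (M : ℤ) ^ n * l) * α n (j - (M : ℤ) * k))).Finite := by
      intro k
      refine (finite_support_dilate hM0 hfin n v k).subset fun l hl => ?_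
      exact left_ne_zero_of_mul (right_ne_zero_of_mul hl)
    rw [finsum_congr e, finsum_sum_comm _ _ fun k _ => hk k]
    simp only [subdivSeq]
    rw [hs, Finset.mul_sum]
    refine Finset.sum_congr rfl fun k _ => ?_
    rw [ih, finsum_mul' _ _ (finite_support_dilate hM0 hfin n v k), mul_finsum']
    refine (finite_support_dilate hM0 hfin n v k).subset fun l hl => ?_
    exact left_ne_zero_of_mul hl

/-- The symbol of `S_{a,M} v` at `z` is `M v(z ^ M) a(z)`. -/
lemma maskSymbol_subdivOp {M : ℕ} {a v : ℤ → ℂ}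
    (ha : (Function.support a).Finite) (hv : (Function.support v).Finite) {z : ℂ} (hz : z ≠ 0) :
    maskSymbol (subdivOp M a v) z = M * (maskSymbol v (z ^ M) * maskSymbol a z) := by
  set s := hv.toFinset
  have h1 : ∀ j : ℤ, subdivOp M a v j * z ^ j =
      ∑ k ∈ s, (M : ℂ) * v k * (z ^ M) ^ k * (a (j - M * k) * z ^ (j - M * k)) := by
    intro j
    rw [subdivOp, finsum_eq_sum_of_support_subset (s := s), Finset.mul_sum, Finset.sum_mul]
    · refine Finset.sum_congr rfl fun k _ => ?_
      have : z ^ j = (z ^ M) ^ k * z ^ (j - M * k) := by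
        rw [← zpow_natCast z M, ← zpow_mul, ← zpow_add₀ hz]
        congr 1; ring
      rw [this]; ring
    · intro k hk
      simpa [s] using left_ne_zero_of_mul hk
  have hfin : ∀ k : ℤ, (Function.support fun j : ℤ =>
      (a (j - M * k) * z ^ (j - M * k))).Finite := fun k =>
    (finite_support_shift ha (M * k)).subset fun j hj => left_ne_zero_of_mul hj
  simp only [maskSymbol]
  rw [finsum_congr h1, finsum_sum_comm]
  · rw [finsum_eq_sum_of_support_subset (s := s) (f := fun k => v k * (z ^ M) ^ k),
      Finset.sum_mul, Finset.mul_sum]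
    · refine Finset.sum_congr rfl fun k _ => ?_
      rw [← mul_finsum' _ _ (hfin k)]
      have := finsum_comp_equiv (Equiv.subRight ((M : ℤ) * k)) (f := fun j => a j * z ^ j)
      simp only [Equiv.subRight_apply] at this
      rw [this]; ring
    · intro k hk
      simpa [s] using left_ne_zero_of_mul hk
  · intro k _
    exact (hfin k).subset fun j hj => right_ne_zero_of_mul hj

/-! ### Sum rules -/

lemma finite_support_mul_zpow {b : ℤ → ℂ} (hb : (Function.support b).Finite) (z : ℂ) :
    (Function.support fun k : ℤ => b k * z ^ k).Finite :=
  hb.subset fun _ hk => left_ne_zero_of_mul hk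

lemma maskSymbol_boxSum (M : ℕ) {b : ℤ → ℂ} (hb : (Function.support b).Finite) {z : ℂ}
    (hz : z ≠ 0) :
    maskSymbol (boxSum M b) z = (∑ i ∈ Finset.range M, z ^ i) * maskSymbol b z := by
  simp only [maskSymbol, boxSum, Finset.sum_mul]
  rw [finsum_sum_comm]
  · refine Finset.sum_congr rfl fun i _ => ?_
    rw [mul_finsum' _ _ (finite_support_mul_zpow hb z),
      ← finsum_comp_equiv (Equiv.addRight (i : ℤ))]
    refine finsum_congr fun k => ?_
    simp only [Equiv.coe_addRight, add_sub_cancel_right, zpow_add₀ hz, zpow_natCast]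
    ring
  · exact fun i _ => finite_support_mul_zpow (finite_support_shift hb i) z

lemma maskSymbol_boxSum_iterate (M J : ℕ) {b : ℤ → ℂ} (hb : (Function.support b).Finite) {z : ℂ}
    (hz : z ≠ 0) :
    maskSymbol ((boxSum M)^[J] b) z = (∑ i ∈ Finset.range M, z ^ i) ^ J * maskSymbol b z := by
  induction J with
  | zero => simp
  | succ J ih =>
    rw [Function.iterate_succ_apply', maskSymbol_boxSum M (finite_support_boxSum_iterate M J hb) hz,
      ih, pow_succ]
    ring

/-- A finitely supported sequence is determined by its symbol: the characters `z ↦ z ^ k` of the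
group `ℂˣ` are linearly independent. -/
lemma eq_of_maskSymbol_eq {a b : ℤ → ℂ} (ha : (Function.support a).Finite)
    (hb : (Function.support b).Finite) (h : ∀ z : ℂ, z ≠ 0 → maskSymbol a z = maskSymbol b z) :
    a = b := by
  set s := ha.toFinset ∪ hb.toFinset
  have hinj : Function.Injective fun k : ℤ => ((Units.coeHom ℂ).comp (zpowGroupHom k)) := by
    intro k l hkl
    -- evaluation at `2` separates the characters
    have := DFunLike.congr_fun hkl (Units.mk0 (2 : ℂ) two_ne_zero)
    simp only [MonoidHom.comp_apply, zpowGroupHom_apply, Units.coeHom_apply,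
      Units.val_zpow_eq_zpow_val, Units.val_mk0] at this
    have h2 : ((2 : ℝ) : ℂ) ^ k = ((2 : ℝ) : ℂ) ^ l := by simpa using this
    rw [← Complex.ofReal_zpow, ← Complex.ofReal_zpow, Complex.ofReal_inj] at h2
    exact zpow_right_injective₀ (by norm_num) (by norm_num) h2
  have hli := (linearIndependent_monoidHom ℂˣ ℂ).comp _ hinj
  rw [linearIndependent_iff'] at hli
  have hz := hli s (fun k => a k - b k) (by
    funext u
    have hu := h u u.ne_zero
    rw [maskSymbol, maskSymbol, finsum_eq_sum_of_support_subset (s := s),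
      finsum_eq_sum_of_support_subset (s := s)] at hu
    · simp only [Finset.sum_apply, Pi.smul_apply, Function.comp_apply, MonoidHom.comp_apply,
        zpowGroupHom_apply, Units.coeHom_apply, Units.val_zpow_eq_zpow_val, smul_eq_mul, sub_mul,
        Finset.sum_sub_distrib, Pi.zero_apply, hu, sub_self]
    · intro k hk
      have : b k ≠ 0 := left_ne_zero_of_mul hk
      simp [s, this]
    · intro k hk
      have : a k ≠ 0 := left_ne_zero_of_mul hk
      simp [s, this])
  funext k
  by_cases hk : k ∈ s
  · exact sub_eq_zero.1 (hz k hk)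
  · simp only [s, Finset.mem_union, Set.Finite.mem_toFinset, Function.mem_support, not_or,
      not_not] at hk
    rw [hk.1, hk.2]

lemma hasSumRules_iff {M J : ℕ} {a : ℤ → ℂ} (ha : (Function.support a).Finite) :
    HasSumRules M a J ↔ ∃ b : ℤ → ℂ, (Function.support b).Finite ∧ a = (boxSum M)^[J] b := by
  refine exists_congr fun b => and_congr_right fun hb => ⟨fun h => ?_, ?_⟩
  · refine eq_of_maskSymbol_eq ha (finite_support_boxSum_iterate M J hb) fun z hz => ?_
    rw [h z hz, maskSymbol_boxSum_iterate M J hb hz]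
  · rintro rfl z hz
    exact maskSymbol_boxSum_iterate M J hb hz

lemma eq_of_backwardDiff_eq {f g : ℤ → ℂ} (hf : (Function.support f).Finite)
    (hg : (Function.support g).Finite) (h : backwardDiff f = backwardDiff g) : f = g := by
  obtain ⟨K, -, hK⟩ := exists_supportedIn hf
  obtain ⟨L, -, hL⟩ := exists_supportedIn hg
  have low : ∀ k : ℤ, k ≤ -(|K| + |L| + 1) → f k = g k := fun k hk => by
    have hK' := le_abs_self K
    have hL' := le_abs_self L
    have hk' := neg_le_abs k
    have := abs_nonneg K
    have := abs_nonneg L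
    rw [hK k (by linarith), hL k (by linarith)]
  funext k
  rcases le_total k (-(|K| + |L| + 1)) with hk | hk
  · exact low k hk
  · induction k, hk using Int.leInduction with
    | base => exact low _ le_rfl
    | succ n _ ih =>
      have := congrFun h (n + 1)
      simp only [backwardDiff, add_sub_cancel_right, ih] at this
      exact sub_left_injective this

/-- If the sums of `a` over the cosets of `Mℤ` all agree, then `1 + z + ⋯ + z ^ (M - 1)` divides
the symbol of `a`. -/
lemma exists_eq_boxSum {M : ℕ} (hM : M ≠ 0) {a : ℤ → ℂ} (ha : (Function.support a).Finite)
    {c : ℂ} (h : ∀ γ : ℤ, ∑ᶠ k : ℤ, a (γ - (M : ℤ) * k) = c) :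
    ∃ b : ℤ → ℂ, (Function.support b).Finite ∧ a = boxSum M b := by
  obtain ⟨L, hL0, hL⟩ := exists_supportedIn ha
  have hd : ∀ k : ℤ, L + 1 < |k| → backwardDiff a k = 0 := by
    intro k hk
    have : |k| ≤ |k - 1| + 1 := by simpa using abs_add_le (k - 1) 1
    rw [backwardDiff, hL k (by linarith), hL (k - 1) (by linarith), sub_zero]
  have hdfin : (Function.support (backwardDiff a)).Finite :=
    SupportedIn.finite (L := L + 1) hd
  have hZ : ∀ k : ℤ, (Function.support fun i : ℤ => backwardDiff a (k - M * i)).Finite := by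
    intro k
    simpa using finite_support_subdiv hM hdfin (fun _ => 1) k
  have hN : ∀ k : ℤ, Summable fun i : ℕ => backwardDiff a (k - M * i) := fun k =>
    summable_of_hasFiniteSupport ((hZ k).preimage (f := fun i : ℕ => (i : ℤ))
      Nat.cast_injective.injOn)
  -- `b = ∑_{i ≥ 0} (∇ a)(· - M i)` is the expansion of `(1 - z) a(z) / (1 - z ^ M)`
  set b : ℤ → ℂ := fun k => ∑' i : ℕ, backwardDiff a (k - M * i) with hb
  have hrec : ∀ k, b k - b (k - M) = backwardDiff a k := by
    intro k
    have h0 : b k = _ := (hN k).tsum_eq_zero_add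
    have h1 : b (k - M) = ∑' i : ℕ, backwardDiff a (k - M * ((i + 1 : ℕ) : ℤ)) := by
      rw [hb]
      refine tsum_congr fun i => ?_
      congr 1
      push_cast
      ring
    rw [h0, h1]
    simp
  have hbfin : (Function.support b).Finite := by
    refine SupportedIn.finite (L := L + 1) fun k hk => ?_
    rcases lt_abs.1 hk with hk | hk
    · have e1 : b k = ∑' i : ℤ, backwardDiff a (k - M * i) := by
        refine Function.Injective.tsum_eq (g := fun i : ℕ => (i : ℤ))
          (f := fun i : ℤ => backwardDiff a (k - M * i)) Nat.cast_injective fun i hi => ?_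
        by_contra hne
        have hi0 : i < 0 := by
          by_contra h0
          exact hne ⟨i.toNat, Int.toNat_of_nonneg (not_lt.1 h0)⟩
        refine hi (hd _ (lt_of_lt_of_le ?_ (le_abs_self _)))
        nlinarith
      rw [e1, tsum_eq_finsum (hZ k)]
      have e2 : ∀ γ : ℤ, (Function.support fun i : ℤ => a (γ - M * i)).Finite := by
        intro γ
        simpa using finite_support_subdiv hM ha (fun _ => 1) γ
      have e3 : ∀ i : ℤ, backwardDiff a (k - M * i) = a (k - M * i) - a (k - 1 - M * i) := by
        intro i
        rw [backwardDiff]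
        congr 2
        ring
      rw [finsum_congr e3, finsum_sub_distrib (e2 k) (e2 (k - 1)), h, h, sub_self]
    · rw [hb]
      refine (tsum_congr fun i : ℕ => hd _ ?_).trans tsum_zero
      refine lt_of_lt_of_le ?_ (neg_le_abs _)
      have : 0 ≤ (M : ℤ) * i := by positivity
      linarith
  refine ⟨b, hbfin, eq_of_backwardDiff_eq ha (finite_support_boxSum M hbfin) ?_⟩
  funext k
  rw [backwardDiff_boxSum, hrec]

lemma finsum_boxSum_coset {M : ℕ} (hM : M ≠ 0) {b : ℤ → ℂ} (hb : (Function.support b).Finite)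
    (γ : ℤ) : ∑ᶠ k : ℤ, boxSum M b (γ - (M : ℤ) * k) = ∑ᶠ k : ℤ, b k := by
  have : NeZero M := ⟨hM⟩
  have h1 := finsum_comp_equiv (Equiv.subLeft γ) (f := b)
  have h2 := finsum_comp_equiv (Int.divModEquiv M).symm (f := fun k => b (γ - k))
  simp only [Equiv.subLeft_apply] at h1
  rw [← h1, ← h2, finsum_curry]
  · refine finsum_congr fun k => ?_
    rw [finsum_eq_sum_of_fintype, boxSum, Finset.sum_range]
    refine Finset.sum_congr rfl fun i _ => ?_
    simp only [Int.divModEquiv_symm_apply]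
    congr 1
    ring
  · refine ((hb.preimage (f := fun k : ℤ => γ - k) fun x _ y _ hxy => ?_).preimage
      (Int.divModEquiv M).symm.injective.injOn)
    simpa using hxy

/-- If `(1 + z + ⋯ + z ^ (M - 1)) b(z)` is supported in `[p, q]`, then `b` is supported in
`[p, q - (M - 1)]`. -/
lemma support_of_boxSum {M : ℕ} (hM : M ≠ 0) {b : ℤ → ℂ} (hb : (Function.support b).Finite)
    {p q : ℤ} (h : ∀ k, boxSum M b k ≠ 0 → p ≤ k ∧ k ≤ q) {k : ℤ} (hk : b k ≠ 0) :
    p ≤ k ∧ k ≤ q - (M - 1) := by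
  obtain ⟨l, hl, hmin⟩ := hb.exists_minimal ⟨k, hk⟩
  obtain ⟨u, hu, hmax⟩ := hb.exists_maximal ⟨k, hk⟩
  have hlow : ∀ j, j < l → b j = 0 := fun j hj => by
    by_contra hne
    exact absurd (hmin hne hj.le) (not_le.2 hj)
  have hupp : ∀ j, u < j → b j = 0 := fun j hj => by
    by_contra hne
    exact absurd (hmax hne hj.le) (not_le.2 hj)
  -- at the lowest (highest) point reached, only one summand is nonzero
  have h1 : boxSum M b l = b l := by
    rw [boxSum, Finset.sum_eq_single 0]
    · simp
    · intro i _ hi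
      exact hlow _ (by have : 0 < i := Nat.pos_of_ne_zero hi
                       omega)
    · intro h0
      exact absurd (Finset.mem_range.2 (Nat.pos_of_ne_zero hM)) h0
  have h2 : boxSum M b (u + (M - 1)) = b u := by
    rw [boxSum, Finset.sum_eq_single (M - 1)]
    · congr 1
      have : 1 ≤ M := Nat.one_le_iff_ne_zero.2 hM
      push_cast [this]
      ring
    · intro i hi hne
      have := Finset.mem_range.1 hi
      exact hupp _ (by omega)
    · intro h0
      exact absurd (Finset.mem_range.2 (by omega)) h0
  have h3 := h l (h1 ▸ hl)
  have h4 := h (u + (M - 1)) (h2 ▸ hu)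
  have h5 : l ≤ k := not_lt.1 fun hlt => hk (hlow k hlt)
  have h6 : k ≤ u := not_lt.1 fun hlt => hk (hupp k hlt)
  constructor <;> linarith

lemma support_of_boxSum_iterate {M : ℕ} (hM : M ≠ 0) (J : ℕ) {b : ℤ → ℂ}
    (hb : (Function.support b).Finite)
    {p q : ℤ} (h : ∀ k, (boxSum M)^[J] b k ≠ 0 → p ≤ k ∧ k ≤ q) {k : ℤ} (hk : b k ≠ 0) :
    p ≤ k ∧ k ≤ q - J * (M - 1) := by
  induction J generalizing q with
  | zero => simpa using h k hk
  | succ J ih =>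
    rw [Function.iterate_succ'] at h
    have := ih fun j hj => support_of_boxSum hM (finite_support_boxSum_iterate M J hb) h hj
    push_cast
    constructor <;> linarith

lemma bddAbove_hasSumRules {M : ℕ} (hM : 2 ≤ M) {a : ℤ → ℂ} (ha : (Function.support a).Finite)
    (ha0 : a ≠ 0) : BddAbove {J : ℕ | HasSumRules M a J} := by
  obtain ⟨L, hL0, hL⟩ := exists_supportedIn ha
  refine ⟨(2 * L).toNat, fun J hJ => ?_⟩
  obtain ⟨b, hb, rfl⟩ := (hasSumRules_iff ha).1 hJ
  obtain ⟨k, hk⟩ : ∃ k, b k ≠ 0 := by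
    by_contra! hz
    refine ha0 ?_
    have : b = 0 := funext hz
    have hbox : boxSum M (0 : ℤ → ℂ) = 0 := by
      funext j
      simp [boxSum]
    rw [this, Function.iterate_fixed hbox]
  have h := support_of_boxSum_iterate (M := M) (by omega) J hb (p := -L) (q := L) (fun j hj => by
    rw [← abs_le]
    by_contra hne
    exact hj (hL j (not_le.1 hne))) hk
  have h2 : (J : ℤ) * 1 ≤ J * (M - 1) := mul_le_mul_of_nonneg_left (by omega) (by positivity)
  omega

lemma hasSumRules_zero {M : ℕ} {a : ℤ → ℂ} (ha : (Function.support a).Finite) :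
    HasSumRules M a 0 := ⟨a, ha, fun z _ => by simp⟩

lemma le_sumRuleOrder {M J : ℕ} (hM : 2 ≤ M) {a : ℤ → ℂ} (ha : (Function.support a).Finite)
    (ha0 : a ≠ 0) (h : HasSumRules M a J) : J ≤ sumRuleOrder M a :=
  le_csSup (bddAbove_hasSumRules hM ha ha0) h

lemma hasSumRules_sumRuleOrder {M : ℕ} (hM : 2 ≤ M) {a : ℤ → ℂ}
    (ha : (Function.support a).Finite) (ha0 : a ≠ 0) : HasSumRules M a (sumRuleOrder M a) :=
  Nat.sSup_mem ⟨0, hasSumRules_zero ha⟩ (bddAbove_hasSumRules hM ha ha0)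

lemma exists_eq_boxSum_iterate_of_le {M J : ℕ} (hM : 2 ≤ M) {a : ℤ → ℂ}
    (ha : (Function.support a).Finite) (ha0 : a ≠ 0) (hJ : J ≤ sumRuleOrder M a) :
    ∃ b : ℤ → ℂ, (Function.support b).Finite ∧ a = (boxSum M)^[J] b := by
  obtain ⟨b, hb, h⟩ := (hasSumRules_iff ha).1 (hasSumRules_sumRuleOrder hM ha ha0)
  refine ⟨(boxSum M)^[sumRuleOrder M a - J] b, finite_support_boxSum_iterate _ _ hb, ?_⟩
  rw [← Function.iterate_add_apply, Nat.add_sub_cancel' hJ, ← h]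

lemma geom_sum_mul_geom_sum (M N : ℕ) (z : ℂ) :
    (∑ i ∈ Finset.range N, (z ^ M) ^ i) * ∑ i ∈ Finset.range M, z ^ i =
      ∑ i ∈ Finset.range (M * N), z ^ i := by
  induction N with
  | zero => simp
  | succ N ih =>
    rw [Finset.sum_range_succ, add_mul, ih, Nat.mul_succ, Finset.sum_range_add, Finset.mul_sum]
    simp only [pow_add, pow_mul]

/-- Sum rules of the single masks, with respect to `M`, yield sum rules of the `n`-step masks
with respect to `M ^ n`. -/
lemma maskSymbol_subdivSeq {M : ℕ} (hM : 2 ≤ M) (J : ℕ) {b : ℕ → ℤ → ℂ}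
    (hb : ∀ n, (Function.support (b n)).Finite) (n : ℕ) {z : ℂ} (hz : z ≠ 0) :
    maskSymbol (subdivSeq M (fun i => (boxSum M)^[J] (b i)) n diracSeq) z =
      (∑ i ∈ Finset.range (M ^ n), z ^ i) ^ J * maskSymbol (subdivSeq M b n diracSeq) z := by
  induction n generalizing z with
  | zero => simp [subdivSeq]
  | succ n ih =>
    have hbox := fun i => finite_support_boxSum_iterate M J (hb i)
    have hδ := supportedIn_diracSeq.finite
    simp only [subdivSeq]
    rw [maskSymbol_subdivOp (hbox n) (finite_support_subdivSeq hM hbox hδ n) hz,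
      maskSymbol_subdivOp (hb n) (finite_support_subdivSeq hM hb hδ n) hz,
      ih (pow_ne_zero M hz), maskSymbol_boxSum_iterate M J (hb n) hz, pow_succ' M n,
      ← geom_sum_mul_geom_sum, mul_pow]
    ring

lemma maskSymbol_one (a : ℤ → ℂ) : maskSymbol a 1 = ∑ᶠ k : ℤ, a k := by
  simp [maskSymbol]

lemma maskSymbol_diracSeq (z : ℂ) : maskSymbol diracSeq z = 1 := by
  rw [maskSymbol, finsum_eq_single _ 0 fun k hk => by simp [diracSeq, hk]]
  simp [diracSeq]

lemma finsum_subdivSeq {M : ℕ} (hM : 2 ≤ M) {α : ℕ → ℤ → ℂ}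
    (hα : ∀ n, (Function.support (α n)).Finite) (hsum : ∀ n, ∑ᶠ k : ℤ, α n k = 1) (n : ℕ) :
    ∑ᶠ k : ℤ, subdivSeq M α n diracSeq k = (M : ℂ) ^ n := by
  rw [← maskSymbol_one]
  induction n with
  | zero => simp [subdivSeq, maskSymbol_diracSeq]
  | succ n ih =>
    simp only [subdivSeq]
    rw [maskSymbol_subdivOp (hα n) (finite_support_subdivSeq hM hα supportedIn_diracSeq.finite n)
      one_ne_zero, one_pow, ih, maskSymbol_one, hsum, pow_succ]
    ring

lemma maskSymbol_const_mul (c : ℂ) (b : ℤ → ℂ) (z : ℂ) :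
    maskSymbol (fun k => c * b k) z = c * maskSymbol b z := by
  have h := smul_finsum c fun k : ℤ => b k * z ^ k
  simp only [smul_eq_mul] at h
  simp only [maskSymbol, mul_assoc, h]

section Periodic

variable {M r : ℕ} [NeZero r] {a : Fin r → ℤ → ℂ}

lemma quasiSubdiv_eq (M : ℕ) (a : Fin r → ℤ → ℂ) (n : ℕ) (v : ℤ → ℂ) :
    quasiSubdiv M a n v = subdivSeq M (fun i => a (Fin.ofNat r i)) n v := by
  induction n with
  | zero => rfl
  | succ n ih => simp only [quasiSubdiv, subdivSeq, ih]

lemma iterate_subdivOp_eq (D : ℕ) (a v : ℤ → ℂ) (n : ℕ) :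
    (subdivOp D a)^[n] v = subdivSeq D (fun _ => a) n v := by
  induction n with
  | zero => rfl
  | succ n ih => rw [Function.iterate_succ_apply', ih, subdivSeq]

lemma finite_support_compositeMask (hM : 2 ≤ M) (ha : ∀ ℓ, (Function.support (a ℓ)).Finite) :
    (Function.support (compositeMask M a)).Finite := by
  have := finite_support_subdivSeq hM (α := fun i => a (Fin.ofNat r i)) (fun _ => ha _)
    supportedIn_diracSeq.finite r
  refine this.subset fun k hk => ?_
  rw [← quasiSubdiv_eq]
  exact right_ne_zero_of_mul hk

lemma finsum_compositeMask (hM : 2 ≤ M) (ha : ∀ ℓ, (Function.support (a ℓ)).Finite)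
    (hsum : ∀ ℓ, ∑ᶠ k : ℤ, a ℓ k = 1) : ∑ᶠ k : ℤ, compositeMask M a k = 1 := by
  have h := finsum_subdivSeq hM (α := fun i => a (Fin.ofNat r i)) (fun _ => ha _)
    (fun _ => hsum _) r
  have hM' : (M : ℂ) ≠ 0 := by exact_mod_cast (by omega : M ≠ 0)
  rw [← maskSymbol_one, show compositeMask M a = fun k => ((M : ℂ) ^ r)⁻¹ * quasiSubdiv M a r
    diracSeq k from rfl, maskSymbol_const_mul, maskSymbol_one, quasiSubdiv_eq, h,
    inv_mul_cancel₀ (pow_ne_zero r hM')]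

lemma ne_zero_of_finsum_eq_one {a : ℤ → ℂ} (h : ∑ᶠ k : ℤ, a k = 1) : a ≠ 0 := by
  rintro rfl
  simp at h

lemma hasSumRules_compositeMask (hM : 2 ≤ M) {J : ℕ} {b : Fin r → ℤ → ℂ}
    (hb : ∀ ℓ, (Function.support (b ℓ)).Finite) (hab : ∀ ℓ, a ℓ = (boxSum M)^[J] (b ℓ)) :
    HasSumRules (M ^ r) (compositeMask M a) J := by
  refine ⟨compositeMask M b, finite_support_compositeMask hM hb, fun z hz => ?_⟩
  have h := maskSymbol_subdivSeq hM J (b := fun i => b (Fin.ofNat r i)) (fun _ => hb _) r hz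
  simp only [← hab, ← quasiSubdiv_eq] at h
  simp only [show ∀ a : Fin r → ℤ → ℂ, compositeMask M a = fun k => ((M : ℂ) ^ r)⁻¹ *
    quasiSubdiv M a r diracSeq k from fun _ => rfl, maskSymbol_const_mul, h]
  ring

lemma subdivSeq_add (M : ℕ) (α : ℕ → ℤ → ℂ) (n k : ℕ) (v : ℤ → ℂ) :
    subdivSeq M α (k + n) v = subdivSeq M (fun i => α (k + i)) n (subdivSeq M α k v) := by
  induction n with
  | zero => rfl
  | succ n ih =>
    rw [← add_assoc]
    simp only [subdivSeq, ih]

lemma subdivOp_compositeMask (hM : 2 ≤ M) (ha : ∀ ℓ, (Function.support (a ℓ)).Finite)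
    (v : ℤ → ℂ) : subdivOp (M ^ r) (compositeMask M a) v = quasiSubdiv M a r v := by
  funext j
  have hM' : (M : ℂ) ≠ 0 := by exact_mod_cast (by omega : M ≠ 0)
  have h := smul_finsum ((M : ℂ) ^ r) fun k : ℤ => v k * compositeMask M a (j - (M : ℤ) ^ r * k)
  simp only [smul_eq_mul] at h
  rw [quasiSubdiv_eq, subdivSeq_eq_finsum hM (fun _ => ha _), subdivOp]
  push_cast
  rw [h]
  refine finsum_congr fun k => ?_
  rw [compositeMask, quasiSubdiv_eq]
  field_simp

/-- `r` consecutive steps of the quasi-stationary scheme are one step of the stationary scheme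
with the composite mask. -/
lemma quasiSubdiv_add_mul (hM : 2 ≤ M) (ha : ∀ ℓ, (Function.support (a ℓ)).Finite) (n k : ℕ)
    (v : ℤ → ℂ) : quasiSubdiv M a (r * n + k) v =
      quasiSubdiv M a k (subdivSeq (M ^ r) (fun _ => compositeMask M a) n v) := by
  induction n generalizing v with
  | zero => simp [subdivSeq]
  | succ n ih =>
    have h1 : r * (n + 1) + k = r + (r * n + k) := by ring
    have h2 : (fun i => a (Fin.ofNat r (r + i))) = fun i => a (Fin.ofNat r i) := by
      funext i
      congr 1
      ext
      simp [Fin.ofNat]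
    rw [h1, quasiSubdiv_eq, subdivSeq_add, h2, ← quasiSubdiv_eq, ← quasiSubdiv_eq, ih,
      ← subdivOp_compositeMask hM ha, add_comm n 1, subdivSeq_add]
    rfl

lemma quasiSubdiv_mul (hM : 2 ≤ M) (ha : ∀ ℓ, (Function.support (a ℓ)).Finite) (n : ℕ)
    (v : ℤ → ℂ) : quasiSubdiv M a (r * n) v =
      subdivSeq (M ^ r) (fun _ => compositeMask M a) n v :=
  quasiSubdiv_add_mul hM ha n 0 v

end Periodic

/-! ### Bounds for subdivision operators -/

lemma norm_sub_le_of_backwardDiff_of_le {v : ℤ → ℂ} {B : ℝ} {k l : ℤ} (hlk : l ≤ k)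
    (h : ∀ i, l < i → i ≤ k → ‖backwardDiff v i‖ ≤ B) : ‖v k - v l‖ ≤ ((k - l : ℤ) : ℝ) * B := by
  induction k, hlk using Int.leInduction with
  | base => simp
  | succ n hn ih =>
    have h1 := h (n + 1) (by linarith) le_rfl
    rw [backwardDiff, add_sub_cancel_right] at h1
    calc ‖v (n + 1) - v l‖ ≤ ‖v (n + 1) - v n‖ + ‖v n - v l‖ := norm_sub_le_norm_sub_add_norm_sub ..
      _ ≤ B + ((n - l : ℤ) : ℝ) * B := add_le_add h1 (ih fun i hi hin => h i hi (by linarith))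
      _ = ((n + 1 - l : ℤ) : ℝ) * B := by push_cast; ring

lemma norm_sub_le_of_backwardDiff {v : ℤ → ℂ} {B : ℝ} (h : ∀ k, ‖backwardDiff v k‖ ≤ B)
    (k l : ℤ) : ‖v k - v l‖ ≤ |((k - l : ℤ) : ℝ)| * B := by
  wlog hlk : l ≤ k generalizing k l
  · rw [norm_sub_rev, ← abs_neg, ← Int.cast_neg, neg_sub]
    exact this l k (le_of_not_ge hlk)
  rw [abs_of_nonneg (by exact_mod_cast sub_nonneg.2 hlk)]
  exact norm_sub_le_of_backwardDiff_of_le hlk fun i _ _ => h i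

/-- Only the `k` within distance `L` of `j / M` contribute to sums of the type
`∑ v(k) a(j - M k)`, where `a` is supported in `[-M L, M L]`. -/
lemma mem_Icc_of_abs_sub_le {N L j k : ℤ} (hN : 0 < N) (h : |j - N * k| ≤ L * N) :
    k ∈ Finset.Icc (j / N - L) (j / N + L) := by
  have h1 := Int.mul_ediv_add_emod j N
  have h2 := Int.emod_nonneg j hN.ne'
  have h3 := Int.emod_lt_of_pos j hN
  obtain ⟨h4, h5⟩ := abs_le.1 h
  have h6 : N * (k - j / N) < N * (L + 1) := by linarith
  have h7 : N * (j / N - k) ≤ N * L := by linarith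
  have h8 := lt_of_mul_lt_mul_left h6 hN.le
  have h9 := le_of_mul_le_mul_left h7 hN
  rw [Finset.mem_Icc]
  constructor <;> linarith

lemma finsum_eq_sum_Icc {N L : ℤ} (hN : 0 < N) {f : ℤ → ℂ} (hf : SupportedIn (L * N) f)
    (v : ℤ → ℂ) (j : ℤ) : ∑ᶠ k : ℤ, v k * f (j - N * k) =
      ∑ k ∈ Finset.Icc (j / N - L) (j / N + L), v k * f (j - N * k) := by
  refine finsum_eq_sum_of_support_subset _ fun k hk => ?_
  refine mem_Icc_of_abs_sub_le hN (not_lt.1 fun hlt => hk ?_)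
  simp [hf _ hlt]

lemma card_Icc_window {q L : ℤ} (hL : 0 ≤ L) :
    ((Finset.Icc (q - L) (q + L)).card : ℝ) = 2 * L + 1 := by
  have h : ((Finset.Icc (q - L) (q + L)).card : ℤ) = 2 * L + 1 := by
    rw [Int.card_Icc, Int.toNat_of_nonneg (by linarith)]
    ring
  exact_mod_cast h

lemma norm_sum_Icc_le {q L : ℤ} (hL : 0 ≤ L) {f : ℤ → ℂ} {B : ℝ}
    (h : ∀ k ∈ Finset.Icc (q - L) (q + L), ‖f k‖ ≤ B) :
    ‖∑ k ∈ Finset.Icc (q - L) (q + L), f k‖ ≤ (2 * L + 1) * B := by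
  refine (norm_sum_le_of_le _ h).trans ?_
  rw [Finset.sum_const, nsmul_eq_mul, card_Icc_window hL]

lemma exists_norm_le {a : ℤ → ℂ} (ha : (Function.support a).Finite) :
    ∃ A : ℝ, 0 ≤ A ∧ ∀ k, ‖a k‖ ≤ A := by
  obtain ⟨A, hA⟩ := (ha.image fun k => ‖a k‖).bddAbove
  refine ⟨max A 0, le_max_right _ _, fun k => ?_⟩
  by_cases hk : a k = 0
  · simp [hk]
  · exact (hA (Set.mem_image_of_mem _ hk)).trans (le_max_left _ _)

lemma subdivOp_eq_sum_Icc {M : ℕ} (hM : M ≠ 0) {L : ℤ} (hL : 0 ≤ L) {a : ℤ → ℂ}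
    (ha : SupportedIn L a) (v : ℤ → ℂ) (j : ℤ) :
    subdivOp M a v j = (M : ℂ) * ∑ k ∈ Finset.Icc (j / M - L) (j / M + L),
      v k * a (j - M * k) := by
  have hM1 : (1 : ℤ) ≤ M := by exact_mod_cast Nat.one_le_iff_ne_zero.2 hM
  rw [subdivOp, finsum_eq_sum_Icc (N := (M : ℤ)) (L := L) (by linarith) (ha.mono (by nlinarith))]

/-- Boundedness of the subdivision operator on bounded sequences. -/
lemma exists_norm_subdivOp_le {M : ℕ} (hM : M ≠ 0) {a : ℤ → ℂ}
    (ha : (Function.support a).Finite) :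
    ∃ C : ℝ, 0 ≤ C ∧ ∀ (v : ℤ → ℂ) (B : ℝ), (∀ k, ‖v k‖ ≤ B) →
      ∀ j, ‖subdivOp M a v j‖ ≤ C * B := by
  obtain ⟨L, hL0, hL⟩ := exists_supportedIn ha
  obtain ⟨A, hA0, hA⟩ := exists_norm_le ha
  refine ⟨M * ((2 * L + 1) * A), by positivity, fun v B hv j => ?_⟩
  rw [subdivOp_eq_sum_Icc hM hL0 hL, norm_mul, Complex.norm_natCast]
  calc (M : ℝ) * _ ≤ M * ((2 * L + 1) * (B * A)) := by
        refine mul_le_mul_of_nonneg_left (norm_sum_Icc_le hL0 fun k _ => ?_) (by positivity)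
        rw [norm_mul]
        exact mul_le_mul (hv k) (hA _) (norm_nonneg _) ((norm_nonneg _).trans (hv k))
    _ = _ := by ring

/-- If the mask has constant coset sums `c / M`, then `S v (j)` is `c v(⌊j / M⌋)` up to an error
controlled by the differences of `v`. -/
lemma exists_norm_subdivOp_sub_le {M : ℕ} (hM : M ≠ 0) {a : ℤ → ℂ}
    (ha : (Function.support a).Finite) {c : ℂ}
    (hc : ∀ γ : ℤ, (M : ℂ) * ∑ᶠ k : ℤ, a (γ - (M : ℤ) * k) = c) :
    ∃ C : ℝ, 0 ≤ C ∧ ∀ (v : ℤ → ℂ) (B : ℝ), (∀ k, ‖backwardDiff v k‖ ≤ B) →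
      ∀ j : ℤ, ‖subdivOp M a v j - c * v (j / M)‖ ≤ C * B := by
  obtain ⟨L, hL0, hL⟩ := exists_supportedIn ha
  obtain ⟨A, hA0, hA⟩ := exists_norm_le ha
  refine ⟨M * ((2 * L + 1) * (L * A)), by positivity, fun v B hv j => ?_⟩
  have h1 := subdivOp_eq_sum_Icc hM hL0 hL (fun _ => 1) j
  simp only [subdivOp, one_mul, hc] at h1
  rw [subdivOp_eq_sum_Icc hM hL0 hL, h1, mul_assoc, ← mul_sub, Finset.sum_mul,
    ← Finset.sum_sub_distrib, norm_mul, Complex.norm_natCast]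
  calc (M : ℝ) * _ ≤ M * ((2 * L + 1) * (L * B * A)) := by
        refine mul_le_mul_of_nonneg_left (norm_sum_Icc_le hL0 fun k hk => ?_) (by positivity)
        rw [mul_comm (a _), ← sub_mul, norm_mul]
        have hB : 0 ≤ B := (norm_nonneg _).trans (hv 0)
        refine mul_le_mul ((norm_sub_le_of_backwardDiff hv _ _).trans
          (mul_le_mul_of_nonneg_right ?_ hB)) (hA _) (norm_nonneg _) (by positivity)
        rw [Finset.mem_Icc] at hk
        rw [← Int.cast_abs]
        exact_mod_cast abs_le.2 ⟨by linarith [hk.1], by linarith [hk.2]⟩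
    _ = _ := by ring

lemma finsum_boxSum_iterate (M J : ℕ) {b : ℤ → ℂ} (hb : (Function.support b).Finite) :
    ∑ᶠ k, (boxSum M)^[J] b k = (M : ℂ) ^ J * ∑ᶠ k, b k := by
  simpa [maskSymbol_one] using maskSymbol_boxSum_iterate M J hb one_ne_zero

lemma coset_sum_of_boxSum {M : ℕ} (hM : M ≠ 0) {j : ℕ} {b : ℤ → ℂ}
    (hb : (Function.support b).Finite) (h : ∑ᶠ k, (boxSum M)^[j + 1] b k = 1) (γ : ℤ) :
    (M : ℂ) * ∑ᶠ k : ℤ, boxSum M b (γ - (M : ℤ) * k) = ((M : ℂ) ^ j)⁻¹ := by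
  rw [finsum_boxSum_iterate M _ hb] at h
  rw [finsum_boxSum_coset hM hb]
  refine eq_inv_of_mul_eq_one_left ?_
  rw [← h, pow_succ]
  ring

lemma norm_backwardDiff_iterate_le {f : ℤ → ℂ} {B : ℝ} (h : ∀ k, ‖f k‖ ≤ B) (J : ℕ) (k : ℤ) :
    ‖backwardDiff^[J] f k‖ ≤ 2 ^ J * B := by
  induction J generalizing k with
  | zero => simpa using h k
  | succ J ih =>
    rw [Function.iterate_succ_apply', backwardDiff]
    calc _ ≤ 2 ^ J * B + 2 ^ J * B := (norm_sub_le _ _).trans (add_le_add (ih _) (ih _))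
      _ = _ := by ring

lemma backwardDiff_iterate_eq_zero {f : ℤ → ℂ} {p : ℤ} (h : ∀ k < p, f k = 0) (J : ℕ) :
    ∀ k < p, backwardDiff^[J] f k = 0 := by
  induction J with
  | zero => simpa using h
  | succ J ih =>
    intro k hk
    rw [Function.iterate_succ_apply', backwardDiff, ih k hk, ih (k - 1) (by linarith), sub_zero]

lemma supportedIn_backwardDiff_iterate {f : ℤ → ℂ} {K : ℤ} (h : SupportedIn K f) (J : ℕ) :
    SupportedIn (K + J) (backwardDiff^[J] f) := by
  induction J with
  | zero => simpa using h
  | succ J ih =>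
    intro k hk
    push_cast at hk
    have : |k| ≤ |k - 1| + 1 := by simpa using abs_add_le (k - 1) 1
    rw [Function.iterate_succ_apply', backwardDiff, ih k (by linarith), ih (k - 1) (by linarith),
      sub_zero]

/-- A sequence which vanishes before `p` is controlled on a window of length `W` by its `J`-th
differences on this window. -/
lemma norm_le_of_backwardDiff_iterate {p : ℤ} {W B : ℝ} (hW : 1 ≤ W) (hB : 0 ≤ B) (J : ℕ)
    {f : ℤ → ℂ} (hf : ∀ k < p, f k = 0)
    (h : ∀ k : ℤ, (k : ℝ) + 1 ≤ p + W → ‖backwardDiff^[J] f k‖ ≤ B) (k : ℤ)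
    (hk : (k : ℝ) + 1 ≤ p + W) : ‖f k‖ ≤ W ^ J * B := by
  induction J generalizing B k with
  | zero => simpa using h k hk
  | succ J ih =>
    have key : ∀ l : ℤ, (l : ℝ) + 1 ≤ p + W → ‖backwardDiff^[J] f l‖ ≤ W * B := by
      intro l hl
      have h0 := backwardDiff_iterate_eq_zero hf J
      rcases lt_or_ge l p with hlp | hlp
      · rw [h0 l hlp, norm_zero]
        positivity
      · have aux : ‖backwardDiff^[J] f l‖ ≤ ((l - p + 1 : ℤ) : ℝ) * B := by
          induction l, hlp using Int.leInduction with
          | base =>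
            have := h p hl
            rw [Function.iterate_succ_apply', backwardDiff, h0 (p - 1) (by linarith),
              sub_zero] at this
            simpa using this
          | succ n _ ihn =>
            have h1 := h (n + 1) hl
            push_cast at hl
            have h2 := ihn (by linarith)
            rw [Function.iterate_succ_apply', backwardDiff, add_sub_cancel_right] at h1
            calc _ ≤ ‖backwardDiff^[J] f (n + 1) - backwardDiff^[J] f n‖ +
                  ‖backwardDiff^[J] f n‖ := norm_le_norm_sub_add _ _
              _ ≤ B + ((n - p + 1 : ℤ) : ℝ) * B := add_le_add h1 h2
              _ = _ := by push_cast; ring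
        refine aux.trans (mul_le_mul_of_nonneg_right ?_ hB)
        push_cast
        linarith
    rw [pow_succ, mul_assoc]
    exact ih (by positivity) key k hk

/-- A lower bound for `‖∇^J f‖` in terms of the sum of `f`. -/
lemma norm_finsum_le_of_backwardDiff_iterate {K : ℤ} (hK : 0 ≤ K) {f : ℤ → ℂ}
    (hf : SupportedIn K f) {J : ℕ} {E : ℝ} (hE : ∀ k, ‖backwardDiff^[J] f k‖ ≤ E) :
    ‖∑ᶠ k, f k‖ ≤ (2 * K + 1) ^ (J + 1) * E := by
  have hK' : (0 : ℝ) ≤ K := by exact_mod_cast hK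
  have hE0 : 0 ≤ E := (norm_nonneg _).trans (hE 0)
  rw [finsum_eq_sum_of_support_subset (s := Finset.Icc (0 - K) (0 + K)), pow_succ', mul_assoc]
  · refine norm_sum_Icc_le hK fun k hk => ?_
    rw [Finset.mem_Icc] at hk
    refine norm_le_of_backwardDiff_iterate (p := -K) (by linarith) hE0 J (fun l hl => ?_)
      (fun l _ => hE l) k ?_
    · exact hf l (lt_of_lt_of_le (by linarith) (neg_le_abs l))
    · have : (k : ℝ) ≤ 0 + K := by exact_mod_cast hk.2
      push_cast
      linarith
  · intro k hk
    by_contra hne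
    refine hk (hf k (not_le.1 fun hle => hne ?_))
    rw [zero_sub, zero_add, Finset.coe_Icc, Set.mem_Icc]
    exact abs_le.1 hle

lemma exists_backwardDiff_eq {f : ℤ → ℂ} {p : ℤ} (hf : ∀ k < p, f k = 0) :
    ∃ g : ℤ → ℂ, (∀ k < p, g k = 0) ∧ backwardDiff g = f := by
  refine ⟨fun k => ∑ i ∈ Finset.Icc p k, f i, fun k hk => ?_, ?_⟩
  · simp [hk]
  · funext k
    rcases lt_or_ge k p with hk | hk
    · have : k - 1 < p := by linarith
      simp [backwardDiff, hk, this, hf k hk]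
    · simp only [backwardDiff]
      have : Finset.Icc p k = insert k (Finset.Icc p (k - 1)) := by
        ext i
        simp only [Finset.mem_Icc, Finset.mem_insert]
        omega
      rw [this, Finset.sum_insert (by simp)]
      ring

lemma exists_backwardDiff_iterate_eq {f : ℤ → ℂ} {p : ℤ} (hf : ∀ k < p, f k = 0) (J : ℕ) :
    ∃ g : ℤ → ℂ, (∀ k < p, g k = 0) ∧ backwardDiff^[J] g = f := by
  induction J with
  | zero => exact ⟨f, hf, rfl⟩
  | succ J ih =>
    obtain ⟨g, hg, rfl⟩ := ih
    obtain ⟨g', hg', rfl⟩ := exists_backwardDiff_eq hg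
    exact ⟨g', hg', Function.iterate_succ_apply _ _ _⟩

lemma backwardDiff_iterate_finsum {N : ℤ} (hN : N ≠ 0) {F : ℤ → ℂ}
    (hF : (Function.support F).Finite) (v : ℤ → ℂ) (J : ℕ) :
    backwardDiff^[J] (fun j => ∑ᶠ l : ℤ, v l * F (j - N * l)) =
      fun j => ∑ᶠ l : ℤ, v l * backwardDiff^[J] F (j - N * l) := by
  induction J with
  | zero => rfl
  | succ J ih =>
    funext j
    have hfin : ∀ j, (Function.support fun l : ℤ =>
        v l * backwardDiff^[J] F (j - N * l)).Finite := by
      intro j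
      obtain ⟨K, -, hK⟩ := exists_supportedIn hF
      refine ((supportedIn_backwardDiff_iterate hK J).finite.preimage
        (f := fun l : ℤ => j - N * l) fun x _ y _ hxy => ?_).subset
        fun l hl => right_ne_zero_of_mul hl
      exact mul_left_cancel₀ hN (by linarith)
    rw [Function.iterate_succ_apply', ih, Function.iterate_succ_apply', backwardDiff,
      ← finsum_sub_distrib (hfin _) (hfin _)]
    refine finsum_congr fun l => ?_
    rw [backwardDiff, ← mul_sub, sub_right_comm j 1]

/-- The subdivision process applied to `∇^J v` is determined by its values on `∇^J δ`. -/
lemma subdivSeq_backwardDiff_iterate {M : ℕ} (hM : 2 ≤ M) {b : ℕ → ℤ → ℂ}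
    (hb : ∀ n, (Function.support (b n)).Finite) (n J : ℕ) (v : ℤ → ℂ) (j : ℤ) :
    subdivSeq M b n (backwardDiff^[J] v) j =
      ∑ᶠ l : ℤ, v l * subdivSeq M b n (backwardDiff^[J] diracSeq) (j - (M : ℤ) ^ n * l) := by
  have hM0 : M ≠ 0 := by omega
  have hM1 : (M : ℤ) ^ n ≠ 0 := pow_ne_zero _ (by exact_mod_cast hM0)
  have hbox := fun i => finite_support_boxSum_iterate M J (hb i)
  rw [← backwardDiff_iterate_subdivSeq hM0 hb, ← backwardDiff_iterate_subdivSeq hM0 hb,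
    funext (subdivSeq_eq_finsum hM hbox n v), backwardDiff_iterate_finsum hM1
    (finite_support_subdivSeq hM hbox supportedIn_diracSeq.finite n)]

/-- The operator norm of `S_b^n` on bounded sequences is controlled by its value on the single
sequence `∇^J δ`: on the window on which `S_b^n f (j)` depends, `f` is the `J`-th difference of
a sequence `g` which is bounded there by a multiple of `‖f‖` that does not depend on `n`. -/
lemma exists_norm_subdivSeq_le {M : ℕ} (hM : 2 ≤ M) {b : ℤ → ℂ}
    (hb : (Function.support b).Finite) (J : ℕ) :
    ∃ C : ℝ, 0 ≤ C ∧ ∀ (n : ℕ) (f : ℤ → ℂ) (B E : ℝ), (∀ k, ‖f k‖ ≤ B) →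
      (∀ k, ‖subdivSeq M (fun _ => b) n (backwardDiff^[J] diracSeq) k‖ ≤ E) →
      ∀ j, ‖subdivSeq M (fun _ => b) n f j‖ ≤ C * B * E := by
  obtain ⟨L, hL0, hL⟩ := exists_supportedIn hb
  have hL0' : (0 : ℝ) ≤ L := by exact_mod_cast hL0
  set W : ℝ := 2 * L + J + 1 with hWdef
  have hW : 1 ≤ W := by linarith
  refine ⟨(2 * ((J + L : ℤ) : ℝ) + 1) * W ^ J, by positivity, fun n f B E hf hE j => ?_⟩
  have hB : 0 ≤ B := (norm_nonneg _).trans (hf 0)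
  have hN : (0 : ℤ) < (M : ℤ) ^ n := by positivity
  set N : ℤ := (M : ℤ) ^ n with hNdef
  set p : ℤ := j / N - L with hp
  have hδ := subdivSeq_support hM hL0 (fun _ => hL) supportedIn_diracSeq n
  have hδJ := subdivSeq_support hM hL0 (fun _ => hL)
    (supportedIn_backwardDiff_iterate supportedIn_diracSeq J) n
  rw [zero_add] at hδ hδJ
  -- only the values of `f` on `[j / N - L, j / N + L]` matter, so `f` may be replaced by `0` before
  -- this window; then `f` is the `J`-th difference of a sequence which also vanishes there
  obtain ⟨g, hg0, hg⟩ := exists_backwardDiff_iterate_eq (f := fun k => if k < p then 0 else f k)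
    (p := p) (fun k hk => by simp [hk]) J
  have hloc : subdivSeq M (fun _ => b) n f j =
      subdivSeq M (fun _ => b) n (backwardDiff^[J] g) j := by
    rw [subdivSeq_eq_finsum hM (fun _ => hb), subdivSeq_eq_finsum hM (fun _ => hb) n _ j,
      finsum_eq_sum_Icc hN hδ, finsum_eq_sum_Icc hN hδ, hg]
    refine Finset.sum_congr rfl fun k hk => ?_
    dsimp only
    rw [if_neg (not_lt.2 (Finset.mem_Icc.1 hk).1)]
  rw [hloc, subdivSeq_backwardDiff_iterate hM (fun _ => hb), finsum_eq_sum_Icc hN hδJ]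
  calc _ ≤ (2 * ((J + L : ℤ) : ℝ) + 1) * (W ^ J * B * E) := by
        refine norm_sum_Icc_le (by positivity) fun k hk => ?_
        rw [Finset.mem_Icc] at hk
        rw [norm_mul]
        refine mul_le_mul ?_ (hE _) (norm_nonneg _) (by positivity)
        refine norm_le_of_backwardDiff_iterate hW hB J hg0 (fun l _ => ?_) k ?_
        · rw [hg]
          dsimp only
          split_ifs
          · simpa using hB
          · exact hf l
        · have : (k : ℝ) ≤ ((j / N + (J + L) : ℤ) : ℝ) := by exact_mod_cast hk.2
          rw [hp]
          push_cast at this ⊢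
          linarith
    _ = _ := by ring

/-! ### Geometric decay of differences and the smoothness exponent -/

lemma exists_geometric_of_step {e : ℕ → ℝ} (he : ∀ n, 0 ≤ e n) {n₀ : ℕ} (hn₀ : 0 < n₀)
    {κ μ : ℝ} (hμ : 0 < μ) (hκ : κ < μ ^ n₀) (h : ∀ n, e (n + n₀) ≤ κ * e n) :
    ∃ C θ : ℝ, 0 < θ ∧ θ < μ ∧ ∀ n, e n ≤ C * θ ^ n := by
  -- by continuity of the power function, `κ < θ ^ n₀` holds for some `θ` below `μ`
  obtain ⟨θ, ⟨hθκ, hθ0⟩, hθμ⟩ : ∃ θ : ℝ, (κ < θ ^ n₀ ∧ 0 < θ) ∧ θ < μ := by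
    have h1 : ∀ᶠ θ : ℝ in 𝓝[<] μ, κ < θ ^ n₀ :=
      (((continuous_pow n₀).tendsto μ).mono_left nhdsWithin_le_nhds).eventually
        (lt_mem_nhds hκ)
    have h2 : ∀ᶠ θ : ℝ in 𝓝[<] μ, 0 < θ :=
      mem_nhdsWithin_of_mem_nhds (lt_mem_nhds hμ)
    exact ((h1.and h2).and self_mem_nhdsWithin).exists
  refine ⟨∑ i ∈ Finset.range n₀, e i / θ ^ i, θ, hθ0, hθμ, fun n => ?_⟩
  have hnn : ∀ i ∈ Finset.range n₀, 0 ≤ e i / θ ^ i := fun i _ => div_nonneg (he i) (by positivity)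
  induction n using Nat.strong_induction_on with
  | _ n ih =>
    rcases lt_or_ge n n₀ with hn | hn
    · rw [← div_le_iff₀ (by positivity)]
      exact Finset.single_le_sum hnn (Finset.mem_range.2 hn)
    · obtain ⟨k, rfl⟩ := Nat.exists_eq_add_of_le' hn
      calc e (k + n₀) ≤ κ * e k := h k
        _ ≤ θ ^ n₀ * e k := mul_le_mul_of_nonneg_right hθκ.le (he k)
        _ ≤ θ ^ n₀ * (_ * θ ^ k) := mul_le_mul_of_nonneg_left (ih k (by omega)) (by positivity)
        _ = _ := by ring

lemma root_le {e K μ : ℝ} (he : 0 ≤ e) (hK : 0 ≤ K) (hμ : 0 ≤ μ) {n : ℕ} (hn : n ≠ 0)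
    (h : e ≤ K * μ ^ n) : e ^ (1 / (n : ℝ)) ≤ K ^ (1 / (n : ℝ)) * μ := by
  refine (Real.rpow_le_rpow he h (by positivity)).trans ?_
  rw [Real.mul_rpow hK (by positivity), one_div, Real.pow_rpow_inv_natCast hμ hn]

lemma le_root {e K μ : ℝ} (hK : 0 ≤ K) (hμ : 0 ≤ μ) {n : ℕ} (hn : n ≠ 0)
    (h : K * μ ^ n ≤ e) : K ^ (1 / (n : ℝ)) * μ ≤ e ^ (1 / (n : ℝ)) := by
  refine le_trans ?_ (Real.rpow_le_rpow (by positivity) h (by positivity))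
  rw [Real.mul_rpow hK (by positivity), one_div, Real.pow_rpow_inv_natCast hμ hn]

lemma tendsto_root_mul {K : ℝ} (hK : 0 < K) (μ : ℝ) :
    Tendsto (fun n : ℕ => K ^ (1 / (n : ℝ)) * μ) atTop (𝓝 μ) := by
  have h : Tendsto (fun n : ℕ => K ^ (1 / (n : ℝ))) atTop (𝓝 (K ^ (0 : ℝ))) :=
    (Real.continuous_const_rpow hK.ne').continuousAt.tendsto.comp
      tendsto_one_div_atTop_nhds_zero_nat
  simpa using h.mul_const μ

lemma norm_le_iSup {f : ℤ → ℂ} (hf : (Function.support f).Finite) (k : ℤ) :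
    ‖f k‖ ≤ ⨆ k, ‖f k‖ := by
  obtain ⟨A, -, hA⟩ := exists_norm_le hf
  exact le_ciSup (f := fun k => ‖f k‖) ⟨A, by rintro _ ⟨k, rfl⟩; exact hA k⟩ k

lemma finite_support_backwardDiff_iterate {f : ℤ → ℂ} (hf : (Function.support f).Finite)
    (J : ℕ) : (Function.support (backwardDiff^[J] f)).Finite := by
  obtain ⟨K, -, hK⟩ := exists_supportedIn hf
  exact (supportedIn_backwardDiff_iterate hK J).finite

lemma exists_norm_subdivSeq_le_pow {D : ℕ} (hD : D ≠ 0) {a : ℤ → ℂ}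
    (ha : (Function.support a).Finite) :
    ∃ C : ℝ, 0 ≤ C ∧ ∀ n k, ‖subdivSeq D (fun _ => a) n diracSeq k‖ ≤ C ^ n := by
  obtain ⟨C, hC, h⟩ := exists_norm_subdivOp_le hD ha
  refine ⟨C, hC, fun n => ?_⟩
  induction n with
  | zero =>
    intro k
    simp only [subdivSeq, diracSeq, pow_zero]
    split_ifs <;> simp
  | succ n ih =>
    intro k
    rw [pow_succ']
    exact h _ _ ih k

/-- The sum of `S^n δ` is `D ^ n` while its support has length `O(D ^ n)`, so that `∇^J S^n δ`
cannot decay faster than `D ^ (-J n)`. -/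
lemma exists_le_iSup_norm {D : ℕ} (hD : 2 ≤ D) {a : ℤ → ℂ} (ha : (Function.support a).Finite)
    (hsum : ∑ᶠ k, a k = 1) (J : ℕ) :
    ∃ c : ℝ, 0 < c ∧ ∀ n, c * (((D : ℝ) ^ J)⁻¹) ^ n ≤
      ⨆ k, ‖backwardDiff^[J] (subdivSeq D (fun _ => a) n diracSeq) k‖ := by
  obtain ⟨L, hL0, hL⟩ := exists_supportedIn ha
  refine ⟨((2 * (L : ℝ) + 1) ^ (J + 1))⁻¹, by positivity, fun n => ?_⟩
  have hS := subdivSeq_support hD hL0 (fun _ => hL) supportedIn_diracSeq n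
  rw [zero_add] at hS
  have h := norm_finsum_le_of_backwardDiff_iterate (by positivity) hS (J := J)
    (norm_le_iSup (finite_support_backwardDiff_iterate hS.finite J))
  rw [finsum_subdivSeq hD (fun _ => ha) (fun _ => hsum), norm_pow, Complex.norm_natCast] at h
  set e := ⨆ k, ‖backwardDiff^[J] (subdivSeq D (fun _ => a) n diracSeq) k‖
  have he : 0 ≤ e := Real.iSup_nonneg fun k => norm_nonneg _
  have h1 : (1 : ℝ) ≤ (D : ℝ) ^ n := one_le_pow₀ (by exact_mod_cast (by omega : 1 ≤ D))
  have h2 : 2 * ((L * (D : ℤ) ^ n : ℤ) : ℝ) + 1 ≤ (2 * L + 1) * (D : ℝ) ^ n := by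
    push_cast
    linarith
  have h0 : (0 : ℝ) ≤ ((L * (D : ℤ) ^ n : ℤ) : ℝ) := by exact_mod_cast (by positivity)
  have h3 : (D : ℝ) ^ n ≤ ((2 * L + 1) * (D : ℝ) ^ n) ^ (J + 1) * e :=
    h.trans (mul_le_mul_of_nonneg_right (pow_le_pow_left₀ (by linarith) h2 _) he)
  rw [← div_eq_inv_mul, div_le_iff₀ (by positivity), inv_pow,
    inv_le_iff_one_le_mul₀ (by positivity)]
  have h4 : ((2 * L + 1) * (D : ℝ) ^ n) ^ (J + 1) * e =
      (D : ℝ) ^ n * (e * (2 * (L : ℝ) + 1) ^ (J + 1) * ((D : ℝ) ^ J) ^ n) := by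
    rw [mul_pow, pow_succ ((D : ℝ) ^ n), ← pow_mul, ← pow_mul, mul_comm J n]
    ring
  rw [h4] at h3
  nlinarith

/-- `∇^J S_a^n δ` decays like `θ ^ n` with some `θ < D ^ (-m)`. -/
def GeometricDecay (D : ℕ) (a : ℤ → ℂ) (m J : ℕ) : Prop :=
  ∃ C θ : ℝ, 0 < θ ∧ θ < ((D : ℝ) ^ m)⁻¹ ∧
    ∀ n k, ‖backwardDiff^[J] (subdivSeq D (fun _ => a) n diracSeq) k‖ ≤ C * θ ^ n

lemma lt_smInfty_iff {D : ℕ} (hD : 2 ≤ D) {a : ℤ → ℂ} (ha : (Function.support a).Finite)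
    (hsum : ∑ᶠ k, a k = 1) (m : ℕ) :
    (m : ℝ) < smInfty D a ↔ GeometricDecay D a m (sumRuleOrder D a) := by
  set J := sumRuleOrder D a with hJ
  set e : ℕ → ℝ := fun n => ⨆ k, ‖backwardDiff^[J] (subdivSeq D (fun _ => a) n diracSeq) k‖
    with he
  have hD0 : D ≠ 0 := by omega
  have hD1 : (1 : ℝ) < D := by exact_mod_cast (by omega : 1 < D)
  have hDpos : (0 : ℝ) < D := by linarith
  have hfin : ∀ n, (Function.support (backwardDiff^[J]
      (subdivSeq D (fun _ => a) n diracSeq))).Finite := fun n =>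
    finite_support_backwardDiff_iterate
      (finite_support_subdivSeq hD (fun _ => ha) supportedIn_diracSeq.finite n) J
  have he0 : ∀ n, 0 ≤ e n := fun n => Real.iSup_nonneg fun k => norm_nonneg _
  have hrho : rhoInfty D a J = limsup (fun n : ℕ => e n ^ (1 / (n : ℝ))) atTop := by
    simp only [rhoInfty, he, iterate_subdivOp_eq]
  have hcob : IsCoboundedUnder (· ≤ ·) atTop (fun n : ℕ => e n ^ (1 / (n : ℝ))) :=
    isCoboundedUnder_le_of_le atTop fun n => Real.rpow_nonneg (he0 n) _
  have hbdd : IsBoundedUnder (· ≤ ·) atTop (fun n : ℕ => e n ^ (1 / (n : ℝ))) := by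
    obtain ⟨C, hC, h⟩ := exists_norm_subdivSeq_le_pow hD0 ha
    refine (tendsto_root_mul (K := 2 ^ J) (by positivity) C).isBoundedUnder_le.mono_le ?_
    filter_upwards [eventually_ne_atTop 0] with n hn
    exact root_le (he0 n) (by positivity) hC hn
      (ciSup_le fun k => norm_backwardDiff_iterate_le (h n) J k)
  -- positivity matters: the logarithm of `0` has the value `0` here
  have hpos : 0 < rhoInfty D a J := by
    obtain ⟨c, hc, h⟩ := exists_le_iSup_norm hD ha hsum J
    have hlim := tendsto_root_mul hc ((D : ℝ) ^ J)⁻¹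
    have : ((D : ℝ) ^ J)⁻¹ ≤ rhoInfty D a J := by
      rw [hrho, ← hlim.limsup_eq]
      refine limsup_le_limsup ?_ hlim.isCoboundedUnder_le hbdd
      filter_upwards [eventually_ne_atTop 0] with n hn
      exact le_root hc.le (by positivity) hn (h n)
    exact lt_of_lt_of_le (by positivity) this
  have hsm : (m : ℝ) < smInfty D a ↔ rhoInfty D a J < ((D : ℝ) ^ m)⁻¹ := by
    rw [smInfty, ← hJ, lt_neg, Real.logb_lt_iff_lt_rpow hD1 hpos, Real.rpow_neg hDpos.le,
      Real.rpow_natCast]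
  rw [hsm]
  constructor
  · intro h
    obtain ⟨θ, hθ1, hθ2⟩ := exists_between h
    have hθ0 := hpos.trans hθ1
    rw [hrho] at hθ1
    have hev := eventually_lt_of_limsup_lt hθ1 hbdd
    obtain ⟨N, hN⟩ := eventually_atTop.1 (hev.and (eventually_ne_atTop 0))
    have hnn : ∀ i ∈ Finset.range N, 0 ≤ e i / θ ^ i := fun i _ =>
      div_nonneg (he0 i) (by positivity)
    refine ⟨1 + ∑ i ∈ Finset.range N, e i / θ ^ i, θ, hθ0, hθ2, fun n k =>
      (norm_le_iSup (hfin n) k).trans ?_⟩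
    change e n ≤ _
    rw [← div_le_iff₀ (by positivity)]
    rcases lt_or_ge n N with hn | hn
    · have := Finset.single_le_sum hnn (Finset.mem_range.2 hn)
      linarith
    · obtain ⟨h1, h2⟩ := hN n hn
      have h3 : e n ≤ θ ^ n := by
        rw [one_div] at h1
        rw [← Real.rpow_inv_natCast_pow (he0 n) h2]
        exact pow_le_pow_left₀ (Real.rpow_nonneg (he0 n) _) h1.le n
      have h4 : e n / θ ^ n ≤ 1 := (div_le_one (by positivity)).2 h3
      have := Finset.sum_nonneg hnn
      linarith
  · rintro ⟨C, θ, hθ0, hθ, h⟩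
    refine lt_of_le_of_lt ?_ hθ
    have hlim := tendsto_root_mul (K := max C 1) (by positivity) θ
    rw [hrho, ← hlim.limsup_eq]
    refine limsup_le_limsup ?_ hcob hlim.isBoundedUnder_le
    filter_upwards [eventually_ne_atTop 0] with n hn
    refine root_le (he0 n) (by positivity) hθ0.le hn (ciSup_le fun k => (h n k).trans ?_)
    exact mul_le_mul_of_nonneg_right (le_max_left _ _) (by positivity)

/-- Decay of the differences of order `j + 1` yields decay of those of order `j`: if
`a(z) = (1 + ⋯ + z ^ (D - 1)) ^ j b(z)`, then `S_b f (k)` is `D ^ (-j) f(⌊k / D⌋)` up to an error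
controlled by `∇ f`. -/
lemma GeometricDecay.of_succ {D : ℕ} (hD : 2 ≤ D) {m j : ℕ} (hmj : m < j) {b : ℤ → ℂ}
    (hb : (Function.support b).Finite) (hsum : ∑ᶠ k, (boxSum D)^[j + 1] b k = 1)
    (h : GeometricDecay D ((boxSum D)^[j + 1] b) m (j + 1)) :
    GeometricDecay D ((boxSum D)^[j + 1] b) m j := by
  have hD0 : D ≠ 0 := by omega
  have hD1 : (1 : ℝ) < D := by exact_mod_cast (by omega : 1 < D)
  obtain ⟨C, θ, hθ0, hθ, hC⟩ := h
  obtain ⟨C', hC'0, hC'⟩ := exists_norm_subdivOp_sub_le hD0 (finite_support_boxSum D hb)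
    (coset_sum_of_boxSum hD0 hb hsum)
  have hbox : ∀ n, backwardDiff^[j] (subdivSeq D (fun _ => (boxSum D)^[j + 1] b) n diracSeq) =
      subdivSeq D (fun _ => boxSum D b) n (backwardDiff^[j] diracSeq) := fun n => by
    simp only [Function.iterate_succ_apply]
    exact backwardDiff_iterate_subdivSeq hD0 (fun _ => finite_support_boxSum D hb) j n _
  have hlt : max θ ((D : ℝ) ^ j)⁻¹ < ((D : ℝ) ^ m)⁻¹ := by
    refine max_lt hθ ?_
    rw [inv_lt_inv₀ (by positivity) (by positivity)]
    exact pow_lt_pow_right₀ hD1 hmj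
  -- the rate `D ^ (-j)` of the main term is admissible since `m < j`
  obtain ⟨θ', h1, h2⟩ := exists_between hlt
  obtain ⟨h1, h3⟩ := max_lt_iff.1 h1
  have hθ'0 : 0 < θ' := hθ0.trans h1
  have hC0 : 0 ≤ C := by
    have := (norm_nonneg _).trans (hC 0 0)
    simpa using this
  obtain ⟨A, hA0, hA⟩ := exists_norm_le
    (finite_support_backwardDiff_iterate supportedIn_diracSeq.finite j)
  set d := θ' - ((D : ℝ) ^ j)⁻¹ with hd
  have hd0 : 0 < d := sub_pos.2 h3
  -- `C' * C / d` is where the recursion `e ↦ D ^ (-j) e + C' C θ ^ n` is dominated by `θ' e`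
  refine ⟨max A (C' * C / d), θ', hθ'0, h2, fun n => ?_⟩
  induction n with
  | zero => exact fun k => by simpa [subdivSeq] using Or.inl (hA k)
  | succ n ih =>
    intro k
    have hk := hC' (subdivSeq D (fun _ => boxSum D b) n (backwardDiff^[j] diracSeq)) (C * θ ^ n)
      (fun l => by rw [← hbox, ← Function.iterate_succ_apply' backwardDiff]; exact hC n l) k
    rw [← hbox] at hk
    rw [hbox]
    simp only [subdivSeq]
    rw [← hbox]
    have hn := ih (k / D)
    set x := subdivOp D (boxSum D b)
      (backwardDiff^[j] (subdivSeq D (fun _ => (boxSum D)^[j + 1] b) n diracSeq)) k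
    set y := backwardDiff^[j] (subdivSeq D (fun _ => (boxSum D)^[j + 1] b) n diracSeq) (k / D)
    have hy : ‖((D : ℂ) ^ j)⁻¹ * y‖ = ((D : ℝ) ^ j)⁻¹ * ‖y‖ := by
      rw [norm_mul, norm_inv, norm_pow, Complex.norm_natCast]
    calc ‖x‖ ≤ ‖x - ((D : ℂ) ^ j)⁻¹ * y‖ + ‖((D : ℂ) ^ j)⁻¹ * y‖ := norm_le_norm_sub_add _ _
      _ ≤ C' * (C * θ ^ n) + ((D : ℝ) ^ j)⁻¹ * (max A (C' * C / d) * θ' ^ n) := by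
          rw [hy]
          exact add_le_add hk (mul_le_mul_of_nonneg_left hn (by positivity))
      _ ≤ C' * C * θ' ^ n + ((D : ℝ) ^ j)⁻¹ * (max A (C' * C / d) * θ' ^ n) := by
          rw [← mul_assoc]
          gcongr
      _ ≤ max A (C' * C / d) * d * θ' ^ n + ((D : ℝ) ^ j)⁻¹ * (max A (C' * C / d) * θ' ^ n) := by
          have := (div_le_iff₀ hd0).1 (le_max_right A (C' * C / d))
          gcongr
      _ = _ := by rw [hd]; ring

lemma geometricDecay_of_lt_smInfty {D : ℕ} (hD : 2 ≤ D) {a : ℤ → ℂ}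
    (ha : (Function.support a).Finite) (hsum : ∑ᶠ k, a k = 1) {m : ℕ}
    (hsm : (m : ℝ) < smInfty D a) (hsr : m + 1 ≤ sumRuleOrder D a) :
    GeometricDecay D a m (m + 1) := by
  have ha0 := ne_zero_of_finsum_eq_one hsum
  refine Nat.decreasingInduction' (P := fun j => GeometricDecay D a m j) (fun j hj hmj h => ?_)
    hsr ((lt_smInfty_iff hD ha hsum m).1 hsm)
  obtain ⟨b, hb, rfl⟩ := exists_eq_boxSum_iterate_of_le (J := j + 1) hD ha ha0 hj
  exact h.of_succ hD hmj hb hsum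

lemma lt_smInfty_of_small {D : ℕ} (hD : 2 ≤ D) {a : ℤ → ℂ}
    (ha : (Function.support a).Finite) (hsum : ∑ᶠ k, a k = 1) {m : ℕ}
    (hsr : HasSumRules D a (m + 1))
    (h : ∀ ε : ℝ, 0 < ε → ∃ n : ℕ, 0 < n ∧ ∀ k, (D : ℝ) ^ (m * n) *
      ‖backwardDiff^[m + 1] (subdivSeq D (fun _ => a) n diracSeq) k‖ ≤ ε) :
    (m : ℝ) < smInfty D a := by
  have hD0 : D ≠ 0 := by omega
  rw [lt_smInfty_iff hD ha hsum]
  obtain ⟨i, hi⟩ := Nat.exists_eq_add_of_le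
    (le_sumRuleOrder hD ha (ne_zero_of_finsum_eq_one hsum) hsr)
  obtain ⟨b, hb, rfl⟩ := (hasSumRules_iff ha).1 hsr
  have hbox : ∀ n, backwardDiff^[m + 1] (subdivSeq D (fun _ => (boxSum D)^[m + 1] b) n diracSeq) =
      subdivSeq D (fun _ => b) n (backwardDiff^[m + 1] diracSeq) := fun n =>
    backwardDiff_iterate_subdivSeq hD0 (fun _ => hb) (m + 1) n _
  obtain ⟨C, hC0, hC⟩ := exists_norm_subdivSeq_le hD hb (m + 1)
  set e : ℕ → ℝ := fun n => ⨆ k, ‖subdivSeq D (fun _ => b) n (backwardDiff^[m + 1] diracSeq) k‖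
    with he
  have hle : ∀ n k, ‖subdivSeq D (fun _ => b) n (backwardDiff^[m + 1] diracSeq) k‖ ≤ e n :=
    fun n => norm_le_iSup (finite_support_subdivSeq hD (fun _ => hb)
      (finite_support_backwardDiff_iterate supportedIn_diracSeq.finite _) n)
  -- the operator norm of `S_b ^ n₀` is at most `C E < D ^ (-m n₀)`
  obtain ⟨n₀, hn₀, hsmall⟩ := h (C + 1)⁻¹ (by positivity)
  set E : ℝ := (C + 1)⁻¹ / (D : ℝ) ^ (m * n₀) with hE
  have hEk : ∀ k, ‖subdivSeq D (fun _ => b) n₀ (backwardDiff^[m + 1] diracSeq) k‖ ≤ E := by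
    intro k
    rw [hE, le_div_iff₀ (by positivity), mul_comm, ← hbox]
    exact hsmall k
  have hκ : C * E < (((D : ℝ) ^ m)⁻¹) ^ n₀ := by
    rw [hE, inv_pow, ← pow_mul, ← mul_div_assoc, div_lt_iff₀ (by positivity),
      inv_mul_cancel₀ (by positivity), ← div_eq_mul_inv, div_lt_one (by positivity)]
    linarith
  obtain ⟨C', θ, hθ0, hθ, hgeo⟩ := exists_geometric_of_step (e := e)
    (fun n => Real.iSup_nonneg fun k => norm_nonneg _) hn₀ (by positivity) hκ (fun n => by
      refine ciSup_le fun k => ?_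
      rw [subdivSeq_add]
      refine (hC n₀ _ (e n) E (hle n) hEk k).trans_eq ?_
      ring)
  refine ⟨2 ^ i * C', θ, hθ0, hθ, fun n k => ?_⟩
  rw [hi, add_comm (m + 1) i, Function.iterate_add_apply, hbox, mul_assoc]
  exact norm_backwardDiff_iterate_le (fun l => (hle n l).trans (hgeo n)) i k

/-! ### Limits along dyadic points -/

/-- `ψ` is the limit of the functions `M ^ (-n) k ↦ g n k`, uniformly on bounded intervals. -/
def DyadicLimit (M : ℕ) (g : ℕ → ℤ → ℂ) (ψ : ℝ → ℂ) : Prop :=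
  ∀ K : ℝ, 0 < K → ∀ ε : ℝ, 0 < ε → ∀ᶠ n : ℕ in atTop, ∀ k : ℤ, |(k : ℝ)| ≤ (M : ℝ) ^ n * K →
    ‖g n k - ψ ((k : ℝ) / (M : ℝ) ^ n)‖ < ε

lemma DyadicLimit.tendsto {M : ℕ} (hM : M ≠ 0) {g : ℕ → ℤ → ℂ} {ψ : ℝ → ℂ} (hψ : Continuous ψ)
    (h : DyadicLimit M g ψ) {N : ℕ → ℕ} (hN : Tendsto N atTop atTop) {x : ℝ} {k : ℕ → ℤ}
    (hk : Tendsto (fun n => (k n : ℝ) / (M : ℝ) ^ N n) atTop (𝓝 x)) :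
    Tendsto (fun n => g (N n) (k n)) atTop (𝓝 (ψ x)) := by
  have hM' : (0 : ℝ) < M := by exact_mod_cast Nat.pos_of_ne_zero hM
  have h1 : Tendsto (fun n => g (N n) (k n) - ψ ((k n : ℝ) / (M : ℝ) ^ N n)) atTop (𝓝 0) := by
    rw [tendsto_zero_iff_norm_tendsto_zero, Metric.tendsto_nhds]
    intro ε hε
    have h2 : ∀ᶠ n in atTop, |(k n : ℝ) / (M : ℝ) ^ N n| < |x| + 1 :=
      (hk.abs).eventually (gt_mem_nhds (by linarith))
    filter_upwards [hN.eventually (h (|x| + 1) (by positivity) ε hε), h2] with n hn1 hn2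
    rw [Real.dist_0_eq_abs, abs_norm]
    refine hn1 _ ?_
    rw [abs_div, abs_of_pos (pow_pos hM' _), div_lt_iff₀ (by positivity)] at hn2
    linarith
  simpa using h1.add ((hψ.tendsto x).comp hk)

lemma tendsto_div_pow_of_abs_sub_le {M : ℕ} (hM : 2 ≤ M) {N : ℕ → ℕ} (hN : Tendsto N atTop atTop)
    {x C : ℝ} {k : ℕ → ℤ} (hk : ∀ n, |(k n : ℝ) - (M : ℝ) ^ N n * x| ≤ C) :
    Tendsto (fun n => (k n : ℝ) / (M : ℝ) ^ N n) atTop (𝓝 x) := by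
  have hM1 : (1 : ℝ) < M := by exact_mod_cast (by omega : 1 < M)
  have hM0 : (0 : ℝ) < M := by linarith
  have h1 : Tendsto (fun n : ℕ => C * ((M : ℝ)⁻¹) ^ N n) atTop (𝓝 0) := by
    simpa using ((tendsto_pow_atTop_nhds_zero_of_lt_one (by positivity)
      (inv_lt_one_of_one_lt₀ hM1)).comp hN).const_mul C
  rw [tendsto_iff_dist_tendsto_zero]
  refine squeeze_zero (fun n => dist_nonneg) (fun n => ?_) h1
  rw [Real.dist_eq, inv_pow, ← div_eq_mul_inv, le_div_iff₀ (by positivity)]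
  calc _ = |((k n : ℝ) / (M : ℝ) ^ N n - x) * (M : ℝ) ^ N n| := by
        rw [abs_mul, abs_of_pos (pow_pos hM0 _)]
    _ = |(k n : ℝ) - (M : ℝ) ^ N n * x| := by
        congr 1
        field_simp
    _ ≤ C := hk n

lemma abs_floor_sub_le (y : ℝ) : |(⌊y⌋ : ℝ) - y| ≤ 1 := by
  rw [abs_le]
  constructor <;> linarith [Int.floor_le y, Int.lt_floor_add_one y]

lemma tendsto_floor_div {M : ℕ} (hM : 2 ≤ M) (x : ℝ) :
    Tendsto (fun n => (⌊(M : ℝ) ^ n * x⌋ : ℝ) / (M : ℝ) ^ n) atTop (𝓝 x) :=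
  tendsto_div_pow_of_abs_sub_le hM tendsto_id fun _ => abs_floor_sub_le _

lemma floor_pow_succ_div {M : ℕ} (hM : M ≠ 0) (n : ℕ) (x : ℝ) :
    ⌊(M : ℝ) ^ (n + 1) * x⌋ / (M : ℤ) = ⌊(M : ℝ) ^ n * x⌋ := by
  rw [← Int.floor_div_natCast]
  congr 1
  rw [pow_succ]
  field_simp

/-- The step functions `x ↦ g n ⌊M ^ n x⌋` form a uniform Cauchy sequence with jumps tending to
`0`; their limit is continuous. -/
lemma exists_dyadicLimit {M : ℕ} (hM : 2 ≤ M) {g : ℕ → ℤ → ℂ} {C θ : ℝ} (hθ0 : 0 ≤ θ)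
    (hθ1 : θ < 1) (h1 : ∀ n k, ‖g (n + 1) k - g n (k / M)‖ ≤ C * θ ^ n)
    (h2 : ∀ n k, ‖backwardDiff (g n) k‖ ≤ C * θ ^ n) :
    ∃ ψ : ℝ → ℂ, Continuous ψ ∧ DyadicLimit M g ψ := by
  have hM0 : M ≠ 0 := by omega
  have hM' : (0 : ℝ) < M := by positivity
  have hstep : ∀ (x : ℝ) (n : ℕ),
      dist (g n ⌊(M : ℝ) ^ n * x⌋) (g (n + 1) ⌊(M : ℝ) ^ (n + 1) * x⌋) ≤ C * θ ^ n := by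
    intro x n
    rw [dist_comm, dist_eq_norm, ← floor_pow_succ_div hM0 n x]
    exact h1 n _
  choose ψ hψ using fun x => cauchySeq_tendsto_of_complete
    (cauchySeq_of_le_geometric θ C hθ1 (hstep x))
  have hdist : ∀ x n, dist (g n ⌊(M : ℝ) ^ n * x⌋) (ψ x) ≤ C * θ ^ n / (1 - θ) := fun x n =>
    dist_le_of_le_geometric_of_tendsto θ C hθ1 (hstep x) (hψ x) n
  have hsmall : ∀ (A : ℝ) {ε : ℝ}, 0 < ε → ∀ᶠ n : ℕ in atTop, A * θ ^ n < ε := by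
    intro A ε hε
    have : Tendsto (fun n : ℕ => A * θ ^ n) atTop (𝓝 0) := by
      simpa using (tendsto_pow_atTop_nhds_zero_of_lt_one hθ0 hθ1).const_mul A
    exact this.eventually (gt_mem_nhds hε)
  refine ⟨ψ, ?_, fun K _ ε hε => ?_⟩
  · rw [continuous_iff_continuousAt]
    intro x
    rw [Metric.continuousAt_iff]
    intro ε hε
    obtain ⟨n, hn⟩ := (hsmall (2 * (C / (1 - θ)) + C) hε).exists
    refine ⟨((M : ℝ) ^ n)⁻¹, by positivity, fun {y} hy => ?_⟩
    have hfl : |((⌊(M : ℝ) ^ n * y⌋ - ⌊(M : ℝ) ^ n * x⌋ : ℤ) : ℝ)| ≤ 1 := by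
      have hxy : |(M : ℝ) ^ n * y - (M : ℝ) ^ n * x| < 1 := by
        rw [← mul_sub, abs_mul, abs_of_pos (pow_pos hM' n)]
        rw [Real.dist_eq] at hy
        calc _ < (M : ℝ) ^ n * ((M : ℝ) ^ n)⁻¹ := mul_lt_mul_of_pos_left hy (by positivity)
          _ = 1 := mul_inv_cancel₀ (by positivity)
      obtain ⟨ha, hb⟩ := abs_lt.1 hxy
      have e1 := Int.floor_le ((M : ℝ) ^ n * y)
      have e2 := Int.lt_floor_add_one ((M : ℝ) ^ n * y)
      have e3 := Int.floor_le ((M : ℝ) ^ n * x)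
      have e4 := Int.lt_floor_add_one ((M : ℝ) ^ n * x)
      have e5 : ⌊(M : ℝ) ^ n * y⌋ - ⌊(M : ℝ) ^ n * x⌋ < 2 := by
        have : ((⌊(M : ℝ) ^ n * y⌋ - ⌊(M : ℝ) ^ n * x⌋ : ℤ) : ℝ) < 2 := by push_cast; linarith
        exact_mod_cast this
      have e6 : -2 < ⌊(M : ℝ) ^ n * y⌋ - ⌊(M : ℝ) ^ n * x⌋ := by
        have : (-2 : ℝ) < ((⌊(M : ℝ) ^ n * y⌋ - ⌊(M : ℝ) ^ n * x⌋ : ℤ) : ℝ) := by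
          push_cast; linarith
        exact_mod_cast this
      rw [← Int.cast_abs, ← Int.cast_one]
      exact Int.cast_le.2 (abs_le.2 ⟨by linarith, by linarith⟩)
    have hC : 0 ≤ C * θ ^ n := (norm_nonneg _).trans (h2 n 0)
    have hmid := (norm_sub_le_of_backwardDiff (h2 n) ⌊(M : ℝ) ^ n * y⌋ ⌊(M : ℝ) ^ n * x⌋).trans
      (mul_le_of_le_one_left hC hfl)
    calc dist (ψ y) (ψ x) ≤ dist (ψ y) (g n ⌊(M : ℝ) ^ n * y⌋) +
          dist (g n ⌊(M : ℝ) ^ n * y⌋) (g n ⌊(M : ℝ) ^ n * x⌋) +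
          dist (g n ⌊(M : ℝ) ^ n * x⌋) (ψ x) := dist_triangle4 _ _ _ _
      _ ≤ C * θ ^ n / (1 - θ) + C * θ ^ n + C * θ ^ n / (1 - θ) := by
          rw [dist_comm (ψ y), dist_eq_norm (g n _) (g n _)]
          exact add_le_add (add_le_add (hdist y n) hmid) (hdist x n)
      _ = (2 * (C / (1 - θ)) + C) * θ ^ n := by ring
      _ < ε := hn
  · filter_upwards [hsmall (C / (1 - θ)) hε] with n hn k _
    have := hdist ((k : ℝ) / (M : ℝ) ^ n) n
    rw [mul_div_cancel₀ _ (by positivity), Int.floor_intCast, dist_eq_norm] at this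
    refine this.trans_lt (lt_of_eq_of_lt ?_ hn)
    ring

/-- If the scaled differences of `g` converge to `χ`, then the limit of `g` has derivative `χ`. -/
lemma hasDerivAt_of_dyadicLimit {M : ℕ} (hM : 2 ≤ M) {g h : ℕ → ℤ → ℂ} {ψ χ : ℝ → ℂ}
    (hψ : Continuous ψ) (hχ : Continuous χ) (hg : DyadicLimit M g ψ) (hh : DyadicLimit M h χ)
    (heq : ∀ n k, h n k = (M : ℂ) ^ n * backwardDiff (g n) k) (x : ℝ) :
    HasDerivAt ψ (χ x) x := by
  have hM0 : M ≠ 0 := by omega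
  have key : ∀ ε : ℝ, 0 < ε → ∃ δ > 0, ∀ p q : ℝ, p ≤ q → |p - x| < δ → |q - x| < δ →
      ‖ψ q - ψ p - ((q - p : ℝ) : ℂ) * χ x‖ ≤ (q - p) * ε := by
    intro ε hε
    obtain ⟨δ, hδ0, hδ⟩ := Metric.continuous_iff.1 hχ x (ε / 2) (by positivity)
    refine ⟨δ, hδ0, fun p q hpq hp hq => ?_⟩
    set k : ℕ → ℤ := fun n => ⌊(M : ℝ) ^ n * q⌋
    set l : ℕ → ℤ := fun n => ⌊(M : ℝ) ^ n * p⌋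
    have hk := tendsto_floor_div hM q
    have hl := tendsto_floor_div hM p
    have hdisc : ∀ᶠ n in atTop, ‖g n (k n) - g n (l n) -
        (((k n : ℝ) / (M : ℝ) ^ n - (l n : ℝ) / (M : ℝ) ^ n : ℝ) : ℂ) * χ x‖ ≤
        ((k n : ℝ) / (M : ℝ) ^ n - (l n : ℝ) / (M : ℝ) ^ n) * ε := by
      filter_upwards [hh (|x| + δ) (by positivity) (ε / 2) (by positivity)] with n hn
      have hMn : (0 : ℝ) < (M : ℝ) ^ n := by positivity
      have hlk : l n ≤ k n := Int.floor_le_floor (mul_le_mul_of_nonneg_left hpq hMn.le)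
      have hloc : ∀ i, l n < i → i ≤ k n →
          ‖backwardDiff (fun i => g n i - (((i : ℝ) / (M : ℝ) ^ n : ℝ) : ℂ) * χ x) i‖ ≤
            ε / (M : ℝ) ^ n := by
        intro i hi1 hi2
        have hi3 : p < (i : ℝ) / (M : ℝ) ^ n := by
          rw [lt_div_iff₀ hMn, mul_comm]
          exact Int.floor_lt.1 hi1
        have hi4 : (i : ℝ) / (M : ℝ) ^ n ≤ q := by
          rw [div_le_iff₀ hMn, mul_comm]
          exact Int.le_floor.1 hi2
        have hi5 : |(i : ℝ) / (M : ℝ) ^ n - x| < δ := by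
          rw [abs_lt] at hp hq ⊢
          constructor <;> linarith
        have hi6 : |(i : ℝ)| ≤ (M : ℝ) ^ n * (|x| + δ) := by
          have h1 : |(i : ℝ) / (M : ℝ) ^ n| ≤ |x| + δ := by
            have := abs_sub_abs_le_abs_sub ((i : ℝ) / (M : ℝ) ^ n) x
            linarith
          rw [abs_div, abs_of_pos hMn, div_le_iff₀ hMn] at h1
          linarith
        have e1 := hn i hi6
        have e2 := hδ _ (by rwa [Real.dist_eq])
        have e3 : backwardDiff (fun i => g n i - (((i : ℝ) / (M : ℝ) ^ n : ℝ) : ℂ) * χ x) i =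
            ((M : ℂ) ^ n)⁻¹ * (h n i - χ x) := by
          rw [heq]
          simp only [backwardDiff]
          push_cast
          field_simp
          ring
        rw [e3, norm_mul, norm_inv, norm_pow, Complex.norm_natCast, inv_mul_eq_div]
        refine div_le_div_of_nonneg_right ?_ hMn.le
        calc ‖h n i - χ x‖ ≤ ‖h n i - χ ((i : ℝ) / (M : ℝ) ^ n)‖ +
              ‖χ ((i : ℝ) / (M : ℝ) ^ n) - χ x‖ := norm_sub_le_norm_sub_add_norm_sub _ _ _
          _ ≤ ε / 2 + ε / 2 := add_le_add e1.le (by rw [← dist_eq_norm]; exact e2.le)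
          _ = ε := by ring
      have := norm_sub_le_of_backwardDiff_of_le hlk hloc
      refine (le_of_eq ?_).trans (this.trans_eq ?_)
      · congr 1
        push_cast
        ring
      · push_cast
        ring
    have hcast : Tendsto (fun n => (((k n : ℝ) / (M : ℝ) ^ n - (l n : ℝ) / (M : ℝ) ^ n : ℝ) : ℂ))
        atTop (𝓝 ((q - p : ℝ) : ℂ)) :=
      (Complex.continuous_ofReal.tendsto _).comp (hk.sub hl)
    exact le_of_tendsto_of_tendsto
      (((hg.tendsto hM0 hψ tendsto_id hk).sub (hg.tendsto hM0 hψ tendsto_id hl)).sub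
        (hcast.mul_const (χ x))).norm
      ((hk.sub hl).mul_const ε) hdisc
  rw [hasDerivAt_iff_isLittleO, Asymptotics.isLittleO_iff]
  intro ε hε
  obtain ⟨δ, hδ0, hδ⟩ := key ε hε
  filter_upwards [Metric.ball_mem_nhds x hδ0] with y hy
  rw [Metric.mem_ball, Real.dist_eq] at hy
  have hx : |x - x| < δ := by simpa using hδ0
  rw [Complex.real_smul, Real.norm_eq_abs]
  rcases le_total x y with hxy | hxy
  · rw [abs_of_nonneg (sub_nonneg.2 hxy), mul_comm ε]
    exact hδ x y hxy hx hy
  · rw [abs_of_nonpos (sub_nonpos.2 hxy), mul_comm ε, neg_sub]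
    refine (le_of_eq ?_).trans (hδ y x hxy hy hx)
    rw [← norm_neg]
    congr 1
    push_cast
    ring

/-! ### Convergence for the Dirac sequence -/

section Periodic

variable {M r : ℕ} [NeZero r] {a : Fin r → ℤ → ℂ}

/-- The scaled differences `M ^ (j n) ∇^j S^{n,r} v`, which approximate the `j`-th derivative of
the limit function. -/
noncomputable def scaledDiff (M : ℕ) (a : Fin r → ℤ → ℂ) (v : ℤ → ℂ) (j n : ℕ) : ℤ → ℂ :=
  fun k => (M : ℂ) ^ (j * n) * backwardDiff^[j] (quasiSubdiv M a n v) k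

lemma isQSLimit_iff {m : ℕ} {v : ℤ → ℂ} {η : ℝ → ℂ} :
    IsQSLimit M a m v η ↔ ContDiff ℝ m η ∧
      ∀ j ≤ m, DyadicLimit M (scaledDiff M a v j) (iteratedDeriv j η) :=
  and_congr_right fun _ => ⟨fun h j hj K hK => h K hK j hj, fun h K hK j hj => h j hj K hK⟩

lemma scaledDiff_succ (M : ℕ) (a : Fin r → ℤ → ℂ) (v : ℤ → ℂ) (j n : ℕ) (k : ℤ) :
    scaledDiff M a v (j + 1) n k = (M : ℂ) ^ n * backwardDiff (scaledDiff M a v j n) k := by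
  simp only [scaledDiff, Function.iterate_succ_apply', backwardDiff]
  rw [add_mul, pow_add, one_mul]
  ring

lemma backwardDiff_iterate_quasiSubdiv (hM : M ≠ 0) {b : Fin r → ℤ → ℂ}
    (hb : ∀ ℓ, (Function.support (b ℓ)).Finite) {j : ℕ} (hab : ∀ ℓ, a ℓ = (boxSum M)^[j] (b ℓ))
    (n : ℕ) (v : ℤ → ℂ) :
    backwardDiff^[j] (quasiSubdiv M a n v) = quasiSubdiv M b n (backwardDiff^[j] v) := by
  rw [quasiSubdiv_eq, quasiSubdiv_eq]
  simp only [hab]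
  exact backwardDiff_iterate_subdivSeq hM (fun _ => hb _) j n v

/-- Sum rules of order `j + 1` make consecutive scaled differences of order `j` close. -/
lemma exists_norm_scaledDiff_sub_le (hM : 2 ≤ M) (hsum : ∀ ℓ, ∑ᶠ k : ℤ, a ℓ k = 1)
    {b : Fin r → ℤ → ℂ} (hb : ∀ ℓ, (Function.support (b ℓ)).Finite) {j : ℕ}
    (hab : ∀ ℓ, a ℓ = (boxSum M)^[j + 1] (b ℓ)) (v : ℤ → ℂ) :
    ∃ C : ℝ, 0 ≤ C ∧ ∀ (n : ℕ) (B : ℝ), (∀ l, ‖backwardDiff (scaledDiff M a v j n) l‖ ≤ B) →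
      ∀ k, ‖scaledDiff M a v j (n + 1) k - scaledDiff M a v j n (k / M)‖ ≤ C * B := by
  have hM0 : M ≠ 0 := by omega
  have hbox := fun ℓ => finite_support_boxSum M (hb ℓ)
  have hab' : ∀ ℓ, a ℓ = (boxSum M)^[j] (boxSum M (b ℓ)) := fun ℓ => by
    rw [hab, Function.iterate_succ_apply]
  choose C hC0 hC using fun ℓ => exists_norm_subdivOp_sub_le hM0 (hbox ℓ)
    (coset_sum_of_boxSum hM0 (hb ℓ) (by rw [← hab]; exact hsum ℓ))
  refine ⟨(M : ℝ) ^ j * ∑ ℓ, C ℓ, mul_nonneg (by positivity)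
    (Finset.sum_nonneg fun ℓ _ => hC0 ℓ), fun n B hB k => ?_⟩
  have hB0 : 0 ≤ B := (norm_nonneg _).trans (hB 0)
  set T := fun n => backwardDiff^[j] (quasiSubdiv M a n v) with hT
  have hTsucc : T (n + 1) = subdivOp M (boxSum M (b (Fin.ofNat r n))) (T n) := by
    simp only [hT]
    rw [backwardDiff_iterate_quasiSubdiv hM0 hbox hab',
      backwardDiff_iterate_quasiSubdiv hM0 hbox hab', quasiSubdiv]
  have hdiff : ∀ l, backwardDiff (scaledDiff M a v j n) l =
      (M : ℂ) ^ (j * n) * backwardDiff (T n) l := fun l => by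
    simp only [backwardDiff, scaledDiff, hT]
    ring
  have h1 := hC (Fin.ofNat r n) (T n) (B / (M : ℝ) ^ (j * n)) (fun l => by
    rw [le_div_iff₀ (by positivity), mul_comm]
    have := hB l
    rwa [hdiff, norm_mul, norm_pow, Complex.norm_natCast] at this) k
  rw [← hTsucc] at h1
  have h2 : scaledDiff M a v j (n + 1) k - scaledDiff M a v j n (k / M) =
      (M : ℂ) ^ (j * (n + 1)) * (T (n + 1) k - ((M : ℂ) ^ j)⁻¹ * T n (k / M)) := by
    simp only [scaledDiff, hT]
    rw [mul_add, mul_one, pow_add]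
    field_simp
  rw [h2, norm_mul, norm_pow, Complex.norm_natCast]
  calc _ ≤ (M : ℝ) ^ (j * (n + 1)) * (C (Fin.ofNat r n) * (B / (M : ℝ) ^ (j * n))) :=
        mul_le_mul_of_nonneg_left h1 (by positivity)
    _ = (M : ℝ) ^ j * C (Fin.ofNat r n) * B := by
        rw [mul_add, mul_one, pow_add]
        field_simp
    _ ≤ _ := by
        gcongr
        exact Finset.single_le_sum (fun ℓ _ => hC0 ℓ) (Finset.mem_univ _)

lemma exists_bound_of_geometric {g : ℕ → ℤ → ℂ} {N : ℤ} {A C θ : ℝ} (hθ0 : 0 ≤ θ) (hθ1 : θ < 1)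
    (hA : ∀ k, ‖g 0 k‖ ≤ A) (h : ∀ n k, ‖g (n + 1) k - g n (k / N)‖ ≤ C * θ ^ n) :
    ∀ n k, ‖g n k‖ ≤ A + C / (1 - θ) := by
  have hC : 0 ≤ C := by simpa using (norm_nonneg _).trans (h 0 0)
  have h1 : ∀ n k, ‖g n k‖ ≤ A + C * ∑ i ∈ Finset.range n, θ ^ i := by
    intro n
    induction n with
    | zero => simpa using hA
    | succ n ih =>
      intro k
      rw [Finset.sum_range_succ, mul_add]
      linarith [norm_le_norm_sub_add (g (n + 1) k) (g n (k / N)), h n k, ih (k / N)]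
  intro n k
  refine (h1 n k).trans ?_
  rw [div_eq_mul_inv, ← tsum_geometric_of_lt_one hθ0 hθ1]
  gcongr
  exact (summable_geometric_of_lt_one hθ0 hθ1).sum_le_tsum _ fun i _ => by positivity

/-- Decay of the composite scheme passes to the intermediate steps of the quasi-stationary one. -/
lemma exists_norm_backwardDiff_scaledDiff_le (hM : 2 ≤ M)
    {b : Fin r → ℤ → ℂ} (hb : ∀ ℓ, (Function.support (b ℓ)).Finite) {m : ℕ}
    (hab : ∀ ℓ, a ℓ = (boxSum M)^[m + 1] (b ℓ))
    (h : GeometricDecay (M ^ r) (compositeMask M a) m (m + 1)) :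
    ∃ C θ : ℝ, 0 ≤ θ ∧ θ < 1 ∧
      ∀ n k, ‖backwardDiff (scaledDiff M a diracSeq m n) k‖ ≤ C * θ ^ n := by
  have hM0 : M ≠ 0 := by omega
  have hM1 : (1 : ℝ) ≤ M := by exact_mod_cast (by omega : 1 ≤ M)
  have hr : 0 < r := Nat.pos_of_neZero r
  have ha : ∀ ℓ, (Function.support (a ℓ)).Finite := fun ℓ =>
    hab ℓ ▸ finite_support_boxSum_iterate M (m + 1) (hb ℓ)
  obtain ⟨C, θ, hθ0, hθ, hC⟩ := h
  push_cast at hθ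
  set ϑ : ℝ := ((M : ℝ) ^ r) ^ m * θ with hϑ
  have hϑ1 : ϑ < 1 := by
    rw [hϑ, ← mul_inv_cancel₀ (a := ((M : ℝ) ^ r) ^ m) (by positivity)]
    gcongr
  have hC0 : 0 ≤ C := by simpa using (norm_nonneg _).trans (hC 0 0)
  choose A hA0 hA using fun ℓ => exists_norm_subdivOp_le hM0 (hb ℓ)
  set A' : ℝ := 1 + ∑ ℓ, A ℓ
  have hA'1 : 1 ≤ A' := le_add_of_nonneg_right (Finset.sum_nonneg fun ℓ _ => hA0 ℓ)
  have hsteps : ∀ (s : ℕ) (f : ℤ → ℂ) (B : ℝ), (∀ k, ‖f k‖ ≤ B) →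
      ∀ k, ‖quasiSubdiv M b s f k‖ ≤ A' ^ s * B := by
    intro s f B hf
    have hB : 0 ≤ B := (norm_nonneg _).trans (hf 0)
    induction s with
    | zero => simpa [quasiSubdiv] using hf
    | succ s ih =>
      intro k
      refine (hA _ _ _ ih k).trans ?_
      rw [pow_succ', mul_assoc]
      refine mul_le_mul_of_nonneg_right ?_ (by positivity)
      have := Finset.single_le_sum (fun ℓ _ => hA0 ℓ) (Finset.mem_univ (Fin.ofNat r s))
      simp only [A']
      linarith
  -- `ϑ ^ ⌊n / r⌋` shrinks by the factor `ϑ` in every `r` steps, so it decays geometrically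
  obtain ⟨C', θ', hθ'0, hθ'1, hθ'⟩ := exists_geometric_of_step (e := fun n => ϑ ^ (n / r))
    (fun n => by positivity) hr one_pos (by rwa [one_pow]) (fun n => by
      rw [Nat.add_div_right _ hr, pow_succ'])
  set P : ℝ := (M : ℝ) ^ (m * r) * (A' ^ r * C) with hP
  have hP0 : 0 ≤ P := by positivity
  refine ⟨P * C', θ', hθ'0.le, hθ'1, fun n k => ?_⟩
  have hn := Nat.div_add_mod n r
  have hmod : n % r ≤ r := (Nat.mod_lt n hr).le
  have e1 : backwardDiff (scaledDiff M a diracSeq m n) k =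
      (M : ℂ) ^ (m * n) * quasiSubdiv M b (n % r) (backwardDiff^[m + 1]
        (subdivSeq (M ^ r) (fun _ => compositeMask M a) (n / r) diracSeq)) k := by
    have : backwardDiff (scaledDiff M a diracSeq m n) k =
      (M : ℂ) ^ (m * n) * backwardDiff^[m + 1] (quasiSubdiv M a n diracSeq) k := by
      simp only [backwardDiff, scaledDiff, Function.iterate_succ_apply']
      ring
    rw [this]
    conv_lhs => rw [← hn]
    rw [quasiSubdiv_add_mul hM ha, backwardDiff_iterate_quasiSubdiv hM0 hb hab, hn]
  rw [e1, norm_mul, norm_pow, Complex.norm_natCast]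
  calc _ ≤ (M : ℝ) ^ (m * n) * (A' ^ (n % r) * (C * θ ^ (n / r))) :=
        mul_le_mul_of_nonneg_left (hsteps _ _ _ (hC (n / r)) k) (by positivity)
    _ = (M : ℝ) ^ (m * (n % r)) * (A' ^ (n % r) * C) * ϑ ^ (n / r) := by
        conv_lhs => rw [← hn]
        rw [Nat.mul_add_mod, Nat.mod_mod, hϑ, mul_pow, mul_add, pow_add, ← pow_mul, ← pow_mul,
          Nat.mul_add_div hr, Nat.div_eq_of_lt (Nat.mod_lt n hr), add_zero,
          show m * (r * (n / r)) = r * m * (n / r) by ring]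
        ring
    _ ≤ P * ϑ ^ (n / r) := by
        rw [hP]
        gcongr
    _ ≤ P * (C' * θ' ^ n) := mul_le_mul_of_nonneg_left (hθ' n) hP0
    _ = _ := by ring

lemma exists_eq_boxSum_iterate_succ {M j m : ℕ} (hjm : j ≤ m) {ι : Type*} {a b : ι → ℤ → ℂ}
    (hb : ∀ ℓ, (Function.support (b ℓ)).Finite) (hab : ∀ ℓ, a ℓ = (boxSum M)^[m + 1] (b ℓ)) :
    ∃ b' : ι → ℤ → ℂ, (∀ ℓ, (Function.support (b' ℓ)).Finite) ∧
      ∀ ℓ, a ℓ = (boxSum M)^[j + 1] (b' ℓ) := by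
  refine ⟨fun ℓ => (boxSum M)^[m - j] (b ℓ), fun ℓ => finite_support_boxSum_iterate _ _ (hb ℓ),
    fun ℓ => ?_⟩
  rw [← Function.iterate_add_apply, hab, show j + 1 + (m - j) = m + 1 by omega]

/-- Convergence of the scheme for the Dirac sequence. -/
lemma exists_isQSLimit_diracSeq (hM : 2 ≤ M) (hsum : ∀ ℓ, ∑ᶠ k : ℤ, a ℓ k = 1)
    {b : Fin r → ℤ → ℂ} (hb : ∀ ℓ, (Function.support (b ℓ)).Finite) {m : ℕ}
    (hab : ∀ ℓ, a ℓ = (boxSum M)^[m + 1] (b ℓ))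
    (h : GeometricDecay (M ^ r) (compositeMask M a) m (m + 1)) :
    ∃ φ : ℝ → ℂ, IsQSLimit M a m diracSeq φ := by
  have hM1 : (1 : ℝ) < M := by exact_mod_cast (by omega : 1 < M)
  have ha : ∀ ℓ, (Function.support (a ℓ)).Finite := fun ℓ =>
    hab ℓ ▸ finite_support_boxSum_iterate M (m + 1) (hb ℓ)
  have hstep : ∀ j ≤ m, ∀ C θ : ℝ, 0 ≤ θ → (∀ n k, ‖backwardDiff (scaledDiff M a diracSeq j n) k‖ ≤
      C * θ ^ n) → ∃ C', C ≤ C' ∧ ∀ n k, ‖scaledDiff M a diracSeq j (n + 1) k -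
        scaledDiff M a diracSeq j n (k / M)‖ ≤ C' * θ ^ n := by
    intro j hj C θ hθ0 hC
    obtain ⟨b', hb', hab'⟩ := exists_eq_boxSum_iterate_succ hj hb hab
    obtain ⟨A, hA0, hA⟩ := exists_norm_scaledDiff_sub_le hM hsum hb' hab' diracSeq
    refine ⟨max C (A * C), le_max_left _ _, fun n k => (hA n _ (hC n) k).trans ?_⟩
    rw [← mul_assoc]
    exact mul_le_mul_of_nonneg_right (le_max_right _ _) (by positivity)
  have hdecay : ∀ j ≤ m, ∃ C θ : ℝ, 0 ≤ θ ∧ θ < 1 ∧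
      ∀ n k, ‖backwardDiff (scaledDiff M a diracSeq j n) k‖ ≤ C * θ ^ n := by
    intro j hj
    refine Nat.decreasingInduction' (P := fun j => ∃ C θ : ℝ, 0 ≤ θ ∧ θ < 1 ∧
      ∀ n k, ‖backwardDiff (scaledDiff M a diracSeq j n) k‖ ≤ C * θ ^ n)
      (fun j hjm _ ih => ?_) hj (exists_norm_backwardDiff_scaledDiff_le hM hb hab h)
    obtain ⟨C, θ, hθ0, hθ1, hC⟩ := ih
    obtain ⟨C', -, hC'⟩ := hstep (j + 1) hjm C θ hθ0 hC
    obtain ⟨A, -, hA⟩ := exists_norm_le (a := scaledDiff M a diracSeq (j + 1) 0)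
      ((finite_support_backwardDiff_iterate supportedIn_diracSeq.finite (j + 1)).subset
        fun k hk => right_ne_zero_of_mul hk)
    -- bounded scaled differences of order `j + 1` are `M ^ n` times differences of those of order `j`
    refine ⟨A + C' / (1 - θ), (M : ℝ)⁻¹, by positivity, inv_lt_one_of_one_lt₀ hM1, fun n k => ?_⟩
    have := exists_bound_of_geometric hθ0 hθ1 hA hC' n k
    rw [scaledDiff_succ, norm_mul, norm_pow, Complex.norm_natCast] at this
    rw [inv_pow, ← div_eq_mul_inv, le_div_iff₀ (by positivity), mul_comm]
    exact this
  have hlim : ∀ j, ∃ ψ : ℝ → ℂ, j ≤ m →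
      Continuous ψ ∧ DyadicLimit M (scaledDiff M a diracSeq j) ψ := by
    intro j
    by_cases hj : j ≤ m
    · obtain ⟨C, θ, hθ0, hθ1, hC⟩ := hdecay j hj
      obtain ⟨C', hCC', hC'⟩ := hstep j hj C θ hθ0 hC
      obtain ⟨ψ, hψ⟩ := exists_dyadicLimit hM hθ0 hθ1 hC' fun n k => (hC n k).trans
        (mul_le_mul_of_nonneg_right hCC' (by positivity))
      exact ⟨ψ, fun _ => hψ⟩
    · exact ⟨0, fun h => absurd h hj⟩
  choose ψ hψ using hlim
  have hderiv : ∀ j < m, ∀ x, HasDerivAt (ψ j) (ψ (j + 1) x) x := fun j hj =>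
    hasDerivAt_of_dyadicLimit hM (hψ j hj.le).1 (hψ (j + 1) hj).1 (hψ j hj.le).2
      (hψ (j + 1) hj).2 fun n k => scaledDiff_succ M a diracSeq j n k
  have hiter : ∀ j ≤ m, iteratedDeriv j (ψ 0) = ψ j := by
    intro j
    induction j with
    | zero => exact fun _ => iteratedDeriv_zero
    | succ j ih =>
      intro hj
      rw [iteratedDeriv_succ, ih (by omega)]
      funext x
      exact (hderiv j hj x).deriv
  refine ⟨ψ 0, isQSLimit_iff.2 ⟨?_, fun j hj => by rw [hiter j hj]; exact (hψ j hj).2⟩⟩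
  refine contDiff_nat_iff_iteratedDeriv.2 ⟨fun j hj => ?_, fun j hj => ?_⟩
  · rw [hiter j hj]
    exact (hψ j hj).1
  · rw [hiter j hj.le]
    exact fun x => (hderiv j hj x).differentiableAt

end Periodic

/-! ### Limit functions as superpositions of translates -/

section Periodic

variable {M r : ℕ} [NeZero r] {a : Fin r → ℤ → ℂ}

lemma exists_supportedIn_of_fintype {ι : Type*} [Fintype ι] {a : ι → ℤ → ℂ}
    (ha : ∀ ℓ, (Function.support (a ℓ)).Finite) : ∃ L : ℤ, 0 ≤ L ∧ ∀ ℓ, SupportedIn L (a ℓ) := by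
  choose L hL0 hL using fun ℓ => exists_supportedIn (ha ℓ)
  exact ⟨∑ ℓ, L ℓ, Finset.sum_nonneg fun ℓ _ => hL0 ℓ, fun ℓ =>
    (hL ℓ).mono (Finset.single_le_sum (fun ℓ _ => hL0 ℓ) (Finset.mem_univ ℓ))⟩

lemma supportedIn_quasiSubdiv (hM : 2 ≤ M) {L : ℤ} (hL0 : 0 ≤ L) (hL : ∀ ℓ, SupportedIn L (a ℓ))
    (n : ℕ) : SupportedIn (L * (M : ℤ) ^ n) (quasiSubdiv M a n diracSeq) := by
  rw [quasiSubdiv_eq]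
  simpa using subdivSeq_support hM hL0 (fun n => hL (Fin.ofNat r n)) supportedIn_diracSeq n

lemma supportedIn_scaledDiff (hM : 2 ≤ M) {L : ℤ} (hL0 : 0 ≤ L) (hL : ∀ ℓ, SupportedIn L (a ℓ))
    (j n : ℕ) : SupportedIn ((L + j) * (M : ℤ) ^ n) (scaledDiff M a diracSeq j n) := by
  intro k hk
  have hM1 : (1 : ℤ) ≤ (M : ℤ) ^ n := one_le_pow₀ (by exact_mod_cast (by omega : 1 ≤ M))
  rw [scaledDiff, (supportedIn_backwardDiff_iterate (supportedIn_quasiSubdiv hM hL0 hL n) j).mono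
    (by nlinarith : L * (M : ℤ) ^ n + j ≤ (L + j) * (M : ℤ) ^ n) k hk, mul_zero]

lemma scaledDiff_eq_finsum (hM : 2 ≤ M) (ha : ∀ ℓ, (Function.support (a ℓ)).Finite) (v : ℤ → ℂ)
    (j n : ℕ) (k : ℤ) : scaledDiff M a v j n k =
      ∑ᶠ l : ℤ, v l * scaledDiff M a diracSeq j n (k - (M : ℤ) ^ n * l) := by
  have hM1 : (M : ℤ) ^ n ≠ 0 := pow_ne_zero _ (by exact_mod_cast (by omega : M ≠ 0))
  have hfin := finite_support_subdivSeq hM (α := fun i => a (Fin.ofNat r i)) (fun _ => ha _)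
    supportedIn_diracSeq.finite n
  have h := smul_finsum ((M : ℂ) ^ (j * n)) fun l : ℤ => v l *
    backwardDiff^[j] (quasiSubdiv M a n diracSeq) (k - (M : ℤ) ^ n * l)
  simp only [smul_eq_mul] at h
  simp only [scaledDiff]
  rw [quasiSubdiv_eq M a n v, funext (subdivSeq_eq_finsum hM (fun _ => ha _) n v),
    backwardDiff_iterate_finsum hM1 hfin, ← quasiSubdiv_eq, h]
  exact finsum_congr fun l => by ring

/-- Near the interval `[-K, K]`, only the initial data in `[-N, N]` matter if `N ≥ K + L + j`. -/
lemma scaledDiff_eq_sum (hM : 2 ≤ M) {L : ℤ} (hL0 : 0 ≤ L) (hL : ∀ ℓ, SupportedIn L (a ℓ))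
    (v : ℤ → ℂ) (j n : ℕ) {K : ℝ} {N : ℤ} (hN : K + L + j ≤ N) {k : ℤ}
    (hk : |(k : ℝ)| ≤ (M : ℝ) ^ n * K) : scaledDiff M a v j n k =
      ∑ l ∈ Finset.Icc (-N) N, v l * scaledDiff M a diracSeq j n (k - (M : ℤ) ^ n * l) := by
  rw [scaledDiff_eq_finsum hM fun ℓ => (hL ℓ).finite]
  refine finsum_eq_sum_of_support_subset _ fun l hl => ?_
  have hM0 : (0 : ℝ) < (M : ℝ) ^ n := by positivity
  have h1 : |k - (M : ℤ) ^ n * l| ≤ (L + j) * (M : ℤ) ^ n := by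
    by_contra hlt
    exact right_ne_zero_of_mul hl (supportedIn_scaledDiff hM hL0 hL j n _ (not_le.1 hlt))
  have h2 : |(k : ℝ) - (M : ℝ) ^ n * l| ≤ (L + j) * (M : ℝ) ^ n := by exact_mod_cast h1
  have h3 : (M : ℝ) ^ n * |(l : ℝ)| ≤ (M : ℝ) ^ n * N := by
    calc (M : ℝ) ^ n * |(l : ℝ)| = |(M : ℝ) ^ n * l| := by rw [abs_mul, abs_of_pos hM0]
      _ ≤ |(k : ℝ)| + |(k : ℝ) - (M : ℝ) ^ n * l| := by
        have := abs_sub_abs_le_abs_sub ((M : ℝ) ^ n * l) (k : ℝ)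
        rw [abs_sub_comm] at this
        linarith
      _ ≤ (M : ℝ) ^ n * (K + L + j) := by linarith
      _ ≤ _ := mul_le_mul_of_nonneg_left hN hM0.le
  have h4 : |(l : ℝ)| ≤ N := le_of_mul_le_mul_left h3 hM0
  rw [Finset.coe_Icc, Set.mem_Icc, ← abs_le]
  exact_mod_cast h4

lemma IsQSLimit.tendsto (hM : M ≠ 0) {m : ℕ} {v : ℤ → ℂ} {η : ℝ → ℂ} (h : IsQSLimit M a m v η)
    {N : ℕ → ℕ} (hN : Tendsto N atTop atTop) {x : ℝ} {k : ℕ → ℤ}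
    (hk : Tendsto (fun n => (k n : ℝ) / (M : ℝ) ^ N n) atTop (𝓝 x)) :
    Tendsto (fun n => quasiSubdiv M a (N n) v (k n)) atTop (𝓝 (η x)) := by
  have h0 := (isQSLimit_iff.1 h).2 0 (Nat.zero_le m)
  rw [iteratedDeriv_zero] at h0
  simpa [scaledDiff] using h0.tendsto hM h.1.continuous hN hk

lemma IsQSLimit.eq_zero (hM : 2 ≤ M) {L : ℤ} (hL0 : 0 ≤ L) (hL : ∀ ℓ, SupportedIn L (a ℓ))
    {m : ℕ} {φ : ℝ → ℂ} (h : IsQSLimit M a m diracSeq φ) {x : ℝ} (hx : (L : ℝ) < |x|) :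
    φ x = 0 := by
  have hlim := tendsto_floor_div hM x
  refine tendsto_nhds_unique (h.tendsto (by omega) tendsto_id hlim) (tendsto_const_nhds.congr' ?_)
  filter_upwards [hlim.abs.eventually (lt_mem_nhds hx)] with n hn
  have hM0 : (0 : ℝ) < (M : ℝ) ^ n := by positivity
  refine (supportedIn_quasiSubdiv hM hL0 hL n _ ?_).symm
  rw [abs_div, abs_of_pos hM0, lt_div_iff₀ hM0] at hn
  exact_mod_cast hn

lemma sum_translates_eq {L : ℤ} {φ : ℝ → ℂ} (hφ : ∀ x, (L : ℝ) < |x| → φ x = 0) (v : ℤ → ℂ)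
    {x : ℝ} {N : ℤ} (hN : |x| + L ≤ N) :
    ∑ᶠ l : ℤ, v l * φ (x - l) = ∑ l ∈ Finset.Icc (-N) N, v l * φ (x - l) := by
  refine finsum_eq_sum_of_support_subset _ fun l hl => ?_
  have h1 : |x - l| ≤ L := by
    by_contra hlt
    exact right_ne_zero_of_mul hl (hφ _ (not_le.1 hlt))
  have h2 : |(l : ℝ)| ≤ N := by
    have := abs_sub_abs_le_abs_sub (l : ℝ) x
    rw [abs_sub_comm] at this
    linarith
  rw [Finset.coe_Icc, Set.mem_Icc, ← abs_le]
  exact_mod_cast h2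

/-- The limit functions are the superpositions of the integer translates of the basic one. -/
lemma IsQSLimit.eq_finsum (hM : 2 ≤ M) {L : ℤ} (hL0 : 0 ≤ L) (hL : ∀ ℓ, SupportedIn L (a ℓ))
    {m : ℕ} {φ η : ℝ → ℂ} {v : ℤ → ℂ} (hφ : IsQSLimit M a m diracSeq φ)
    (hη : IsQSLimit M a m v η) (x : ℝ) : η x = ∑ᶠ l : ℤ, v l * φ (x - l) := by
  have hM0 : M ≠ 0 := by omega
  obtain ⟨N, hN⟩ : ∃ N : ℤ, |x| + 1 + L ≤ N := ⟨_, Int.le_ceil _⟩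
  rw [sum_translates_eq (fun x hx => hφ.eq_zero hM hL0 hL hx) v (N := N) (by linarith)]
  have hlim := tendsto_floor_div hM x
  refine tendsto_nhds_unique (hη.tendsto hM0 tendsto_id hlim) (Tendsto.congr' ?_
    (tendsto_finsetSum (f := fun l n => v l *
      quasiSubdiv M a n diracSeq (⌊(M : ℝ) ^ n * x⌋ - (M : ℤ) ^ n * l)) _ fun l _ =>
      (hφ.tendsto hM0 tendsto_id ?_).const_mul (v l)))
  · filter_upwards [hlim.abs.eventually (gt_mem_nhds (lt_add_one |x|))] with n hn
    have hM1 : (0 : ℝ) < (M : ℝ) ^ n := by positivity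
    rw [abs_div, abs_of_pos hM1, div_lt_iff₀ hM1] at hn
    have := scaledDiff_eq_sum hM hL0 hL v 0 n (K := |x| + 1) (N := N)
      (by push_cast; linarith) (k := ⌊(M : ℝ) ^ n * x⌋) (by linarith)
    simpa [scaledDiff] using this.symm
  · have h1 := hlim.sub_const (l : ℝ)
    refine h1.congr fun n => ?_
    simp only [id]
    push_cast
    field_simp

/-- Convergence for the Dirac sequence implies convergence for all initial data. -/
lemma qsConvergent_of_diracSeq (hM : 2 ≤ M) (ha : ∀ ℓ, (Function.support (a ℓ)).Finite) {m : ℕ}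
    {φ : ℝ → ℂ} (hφ : IsQSLimit M a m diracSeq φ) : QSConvergent M a m := by
  intro v
  obtain ⟨L, hL0, hL⟩ := exists_supportedIn_of_fintype ha
  have hzero : ∀ x : ℝ, (L : ℝ) < |x| → φ x = 0 := fun x hx => hφ.eq_zero hM hL0 hL hx
  set η : ℝ → ℂ := fun x => ∑ᶠ l : ℤ, v l * φ (x - l)
  have hloc : ∀ {R : ℝ} {N : ℤ}, R + L ≤ N → ∀ {x : ℝ}, |x| < R →
      η =ᶠ[𝓝 x] fun y => ∑ l ∈ Finset.Icc (-N) N, v l * φ (y - l) := by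
    intro R N hN x hx
    filter_upwards [continuous_abs.continuousAt.eventually (gt_mem_nhds hx)] with y hy
    exact sum_translates_eq hzero v (by linarith)
  have hC : ∀ l : ℤ, ContDiff ℝ m fun y : ℝ => v l * φ (y - l) := fun l =>
    contDiff_const.mul (hφ.1.comp (contDiff_id.sub contDiff_const))
  refine ⟨η, isQSLimit_iff.2 ⟨?_, fun j hj K hK ε hε => ?_⟩⟩
  · rw [contDiff_iff_contDiffAt]
    intro x
    obtain ⟨N, hN⟩ : ∃ N : ℤ, |x| + 1 + L ≤ N := ⟨_, Int.le_ceil _⟩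
    exact (ContDiff.sum fun l _ => hC l).contDiffAt.congr_of_eventuallyEq
      (hloc hN (lt_add_one |x|))
  · obtain ⟨N, hN⟩ : ∃ N : ℤ, K + 1 + L + j ≤ N := ⟨_, Int.le_ceil _⟩
    have hL0' : (0 : ℝ) ≤ L := by exact_mod_cast hL0
    set A : ℝ := ∑ l ∈ Finset.Icc (-N) N, ‖v l‖
    filter_upwards [(isQSLimit_iff.1 hφ).2 j hj (K + N) (by linarith) (ε / (A + 1))
      (by positivity)] with n hn k hk
    have hM1 : (0 : ℝ) < (M : ℝ) ^ n := by positivity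
    have hx : |(k : ℝ) / (M : ℝ) ^ n| < K + 1 := by
      rw [abs_div, abs_of_pos hM1, div_lt_iff₀ hM1]
      nlinarith
    have hder : iteratedDeriv j η ((k : ℝ) / (M : ℝ) ^ n) =
        ∑ l ∈ Finset.Icc (-N) N, v l * iteratedDeriv j φ ((k : ℝ) / (M : ℝ) ^ n - l) := by
      rw [(hloc (R := K + 1) (N := N) (by linarith) hx).iteratedDeriv_eq,
        iteratedDeriv_fun_sum fun l _ =>
          ((hC l).of_le (by exact_mod_cast hj)).contDiffAt]
      refine Finset.sum_congr rfl fun l _ => ?_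
      rw [iteratedDeriv_const_mul_field, iteratedDeriv_comp_sub_const]
    rw [hder, scaledDiff_eq_sum hM hL0 hL v j n (by linarith) hk, ← Finset.sum_sub_distrib]
    calc _ ≤ ∑ l ∈ Finset.Icc (-N) N, ‖v l‖ * (ε / (A + 1)) := by
          refine norm_sum_le_of_le _ fun l hl => ?_
          rw [← mul_sub, norm_mul]
          refine mul_le_mul_of_nonneg_left ?_ (norm_nonneg _)
          have e : (k : ℝ) / (M : ℝ) ^ n - l =
              ((k - (M : ℤ) ^ n * l : ℤ) : ℝ) / (M : ℝ) ^ n := by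
            push_cast
            field_simp
          rw [e]
          refine (hn _ ?_).le
          have hl' : |(l : ℝ)| ≤ N := by
            rw [Finset.mem_Icc, ← abs_le] at hl
            exact_mod_cast hl
          push_cast
          calc |(k : ℝ) - (M : ℝ) ^ n * l| ≤ |(k : ℝ)| + |(M : ℝ) ^ n * l| := abs_sub _ _
            _ ≤ (M : ℝ) ^ n * K + (M : ℝ) ^ n * N := by
              rw [abs_mul, abs_of_pos hM1]
              exact add_le_add hk (mul_le_mul_of_nonneg_left hl' hM1.le)
            _ = _ := by ring
      _ = A / (A + 1) * ε := by rw [← Finset.sum_mul]; ring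
      _ < 1 * ε := by
          refine mul_lt_mul_of_pos_right ?_ hε
          rw [div_lt_one (by positivity)]
          linarith
      _ = ε := one_mul ε

end Periodic

/-! ### Necessity of smoothness and sum rules -/

section Periodic

variable {M r : ℕ} [NeZero r] {a : Fin r → ℤ → ℂ}

/-- The derivatives of the basic limit function do not vanish identically, because the sum of
`S^{n,r} δ` is `M ^ n`. -/
lemma IsQSLimit.exists_iteratedDeriv_ne_zero (hM : 2 ≤ M)
    (ha : ∀ ℓ, (Function.support (a ℓ)).Finite) (hsum : ∀ ℓ, ∑ᶠ k : ℤ, a ℓ k = 1) {m : ℕ}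
    {φ : ℝ → ℂ} (hφ : IsQSLimit M a m diracSeq φ) {j : ℕ} (hj : j ≤ m) :
    ∃ x, iteratedDeriv j φ x ≠ 0 := by
  by_contra! hzero
  obtain ⟨L, hL0, hL⟩ := exists_supportedIn_of_fintype ha
  set P : ℝ := (2 * (L : ℝ) + 1) ^ (j + 1) with hP
  have hP0 : 0 < P := by positivity
  obtain ⟨n, hn⟩ := ((isQSLimit_iff.1 hφ).2 j hj (L + j + 1) (by positivity) (P⁻¹ / 2)
    (by positivity)).exists
  have hMn : (1 : ℝ) ≤ (M : ℝ) ^ n := one_le_pow₀ (by exact_mod_cast (by omega : 1 ≤ M))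
  have hall : ∀ k, ‖backwardDiff^[j] (quasiSubdiv M a n diracSeq) k‖ ≤
      P⁻¹ / 2 / (M : ℝ) ^ (j * n) := by
    intro k
    rw [le_div_iff₀ (by positivity), mul_comm]
    have e : (M : ℝ) ^ (j * n) * ‖backwardDiff^[j] (quasiSubdiv M a n diracSeq) k‖ =
        ‖scaledDiff M a diracSeq j n k‖ := by
      rw [scaledDiff, norm_mul, norm_pow, Complex.norm_natCast]
    rw [e]
    by_cases hk : |(k : ℝ)| ≤ (M : ℝ) ^ n * (L + j + 1)
    · have := hn k hk
      rw [hzero, sub_zero] at this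
      exact this.le
    · rw [supportedIn_scaledDiff hM hL0 hL j n k, norm_zero]
      · positivity
      · have : ((L : ℝ) + j) * (M : ℝ) ^ n < |(k : ℝ)| := by nlinarith [not_le.1 hk]
        exact_mod_cast this
  have h1 := norm_finsum_le_of_backwardDiff_iterate (by positivity)
    (supportedIn_quasiSubdiv hM hL0 hL n) hall
  rw [quasiSubdiv_eq, finsum_subdivSeq hM (fun _ => ha _) (fun _ => hsum _), norm_pow,
    Complex.norm_natCast] at h1
  have h2 : 2 * ((L * (M : ℤ) ^ n : ℤ) : ℝ) + 1 ≤ (2 * L + 1) * (M : ℝ) ^ n := by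
    push_cast
    linarith
  have h0 : (0 : ℝ) ≤ ((L * (M : ℤ) ^ n : ℤ) : ℝ) := by exact_mod_cast (by positivity)
  have h3 : (M : ℝ) ^ n ≤ ((2 * L + 1) * (M : ℝ) ^ n) ^ (j + 1) *
      (P⁻¹ / 2 / (M : ℝ) ^ (j * n)) :=
    h1.trans (mul_le_mul_of_nonneg_right (pow_le_pow_left₀ (by linarith) h2 _) (by positivity))
  have h4 : ((2 * L + 1) * (M : ℝ) ^ n) ^ (j + 1) * (P⁻¹ / 2 / (M : ℝ) ^ (j * n)) =
      (M : ℝ) ^ n / 2 := by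
    rw [mul_pow, ← hP, ← pow_mul, show n * (j + 1) = j * n + n by ring, pow_add]
    field_simp
  linarith

/-- Comparing the values of the scheme at the points `M ⌊M ^ n x⌋ + γ`, for all residues `γ`, with
those of the previous step near `⌊M ^ n x⌋` shows that all coset sums of the masks agree. -/
lemma IsQSLimit.exists_eq_boxSum_succ (hM : 2 ≤ M) (ha : ∀ ℓ, (Function.support (a ℓ)).Finite)
    (hsum : ∀ ℓ, ∑ᶠ k : ℤ, a ℓ k = 1) {m : ℕ} {φ : ℝ → ℂ} (hφ : IsQSLimit M a m diracSeq φ)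
    {j : ℕ} (hj : j ≤ m) {b : Fin r → ℤ → ℂ} (hb : ∀ ℓ, (Function.support (b ℓ)).Finite)
    (hab : ∀ ℓ, a ℓ = (boxSum M)^[j] (b ℓ)) :
    ∃ b' : Fin r → ℤ → ℂ, (∀ ℓ, (Function.support (b' ℓ)).Finite) ∧
      ∀ ℓ, a ℓ = (boxSum M)^[j + 1] (b' ℓ) := by
  have hM0 : M ≠ 0 := by omega
  have hM' : (0 : ℝ) < M := by positivity
  have hMC : (M : ℂ) ≠ 0 := by exact_mod_cast hM0
  -- both sides of the subdivision step converge to multiples of `φ^{(j)}(x)`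
  obtain ⟨x, hx⟩ := hφ.exists_iteratedDeriv_ne_zero hM ha hsum hj
  have hlim := (isQSLimit_iff.1 hφ).2 j hj
  have hcont : Continuous (iteratedDeriv j φ) :=
    hφ.1.continuous_iteratedDeriv j (by exact_mod_cast hj)
  set ψ := iteratedDeriv j φ
  have hcoset : ∀ ℓ γ, ∑ᶠ k : ℤ, b ℓ (γ - (M : ℤ) * k) = ((M : ℂ) ^ (j + 1))⁻¹ := by
    intro ℓ γ
    -- the steps at which the mask with index `ℓ` is used
    set N : ℕ → ℕ := fun q => r * q + ℓ with hNdef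
    have hN : Tendsto N atTop atTop := tendsto_atTop_mono (fun q => by
      have : q ≤ r * q := Nat.le_mul_of_pos_left q (Nat.pos_of_neZero r)
      simp only [hNdef, id]
      omega) tendsto_id
    have hidx : ∀ q, Fin.ofNat r (N q) = ℓ := fun q => by
      ext
      simp [Fin.ofNat, hNdef, Nat.mod_eq_of_lt ℓ.isLt]
    set p : ℕ → ℤ := fun q => ⌊(M : ℝ) ^ N q * x⌋
    obtain ⟨s, hs⟩ := subdivOp_eq_sum hM0 (hb ℓ) γ
    have hleft : Tendsto (fun q => scaledDiff M a diracSeq j (N q + 1) (M * p q + γ)) atTop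
        (𝓝 (ψ x)) := by
      refine hlim.tendsto hM0 hcont (N := fun q => N q + 1)
        (tendsto_atTop_mono (fun q => Nat.le_succ _) hN) ?_
      refine tendsto_div_pow_of_abs_sub_le hM (N := fun q => N q + 1) (C := M + |(γ : ℝ)|)
        (tendsto_atTop_mono (fun q => Nat.le_succ _) hN) fun q => ?_
      have h1 := abs_floor_sub_le ((M : ℝ) ^ N q * x)
      calc |((M * p q + γ : ℤ) : ℝ) - (M : ℝ) ^ (N q + 1) * x|
          = |M * ((p q : ℝ) - (M : ℝ) ^ N q * x) + γ| := by
            congr 1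
            push_cast
            ring
        _ ≤ |M * ((p q : ℝ) - (M : ℝ) ^ N q * x)| + |(γ : ℝ)| := abs_add_le _ _
        _ ≤ M * 1 + |(γ : ℝ)| := by
            rw [abs_mul, abs_of_pos hM']
            gcongr
        _ = _ := by ring
    have hright : ∀ i : ℤ, Tendsto (fun q => scaledDiff M a diracSeq j (N q) (i + p q)) atTop
        (𝓝 (ψ x)) := by
      intro i
      refine hlim.tendsto hM0 hcont hN (tendsto_div_pow_of_abs_sub_le hM hN
        (C := |(i : ℝ)| + 1) fun q => ?_)
      have h1 := abs_floor_sub_le ((M : ℝ) ^ N q * x)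
      calc |((i + p q : ℤ) : ℝ) - (M : ℝ) ^ N q * x|
          = |i + ((p q : ℝ) - (M : ℝ) ^ N q * x)| := by
            congr 1
            push_cast
            ring
        _ ≤ _ := (abs_add_le _ _).trans (by gcongr)
    have hstep : ∀ q, scaledDiff M a diracSeq j (N q + 1) (M * p q + γ) =
        (M : ℂ) ^ (j + 1) * ∑ i ∈ s, scaledDiff M a diracSeq j (N q) (i + p q) *
          b ℓ (γ - (M : ℤ) * i) := by
      intro q
      have h1 := subdivOp_shift M (b ℓ)
        (backwardDiff^[j] (quasiSubdiv M a (N q) diracSeq)) γ (-p q)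
      rw [hs, show γ - (M : ℤ) * -p q = M * p q + γ by ring] at h1
      simp only [scaledDiff]
      rw [backwardDiff_iterate_quasiSubdiv hM0 hb hab, quasiSubdiv, hidx,
        ← backwardDiff_iterate_quasiSubdiv hM0 hb hab, ← h1, mul_add, mul_one, pow_add, pow_succ,
        Finset.mul_sum, Finset.mul_sum, Finset.mul_sum]
      refine Finset.sum_congr rfl fun i _ => ?_
      rw [sub_neg_eq_add]
      ring
    have hsumlim : Tendsto (fun q => scaledDiff M a diracSeq j (N q + 1) (M * p q + γ)) atTop
        (𝓝 ((M : ℂ) ^ (j + 1) * ∑ i ∈ s, ψ x * b ℓ (γ - (M : ℤ) * i))) := by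
      simp only [hstep]
      exact (tendsto_finsetSum _ fun i _ => (hright i).mul_const _).const_mul _
    have heq := tendsto_nhds_unique hleft hsumlim
    have h2 := hs fun _ => 1
    simp only [subdivOp, one_mul] at h2
    rw [mul_right_inj' hMC] at h2
    rw [← Finset.mul_sum, ← h2] at heq
    refine eq_inv_of_mul_eq_one_left (mul_left_cancel₀ hx ?_)
    rw [mul_one]
    conv_rhs => rw [heq]
    ring
  choose b' hb' hbb' using fun ℓ => exists_eq_boxSum hM0 (hb ℓ) (hcoset ℓ)
  refine ⟨b', hb', fun ℓ => ?_⟩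
  rw [Function.iterate_succ_apply, ← hbb', hab]

lemma IsQSLimit.exists_eq_boxSum_iterate (hM : 2 ≤ M)
    (ha : ∀ ℓ, (Function.support (a ℓ)).Finite) (hsum : ∀ ℓ, ∑ᶠ k : ℤ, a ℓ k = 1) {m : ℕ}
    {φ : ℝ → ℂ} (hφ : IsQSLimit M a m diracSeq φ) {j : ℕ} (hj : j ≤ m + 1) :
    ∃ b : Fin r → ℤ → ℂ, (∀ ℓ, (Function.support (b ℓ)).Finite) ∧
      ∀ ℓ, a ℓ = (boxSum M)^[j] (b ℓ) := by
  induction j with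
  | zero => exact ⟨a, ha, fun _ => rfl⟩
  | succ j ih =>
    obtain ⟨b, hb, hab⟩ := ih (by omega)
    exact hφ.exists_eq_boxSum_succ hM ha hsum (by omega) hb hab

/-- Since `φ^{(m)}` is uniformly continuous, `M ^ (m n) ∇^{m+1} S^{n,r} δ` tends to `0`
uniformly. -/
lemma IsQSLimit.eventually_backwardDiff_le (hM : 2 ≤ M)
    (ha : ∀ ℓ, (Function.support (a ℓ)).Finite) {m : ℕ} {φ : ℝ → ℂ}
    (hφ : IsQSLimit M a m diracSeq φ) {ε : ℝ} (hε : 0 < ε) :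
    ∀ᶠ n in atTop, ∀ k, ‖backwardDiff (scaledDiff M a diracSeq m n) k‖ ≤ ε := by
  have hM1 : (1 : ℝ) < M := by exact_mod_cast (by omega : 1 < M)
  obtain ⟨L, hL0, hL⟩ := exists_supportedIn_of_fintype ha
  have hcont : Continuous (iteratedDeriv m φ) := hφ.1.continuous_iteratedDeriv m le_rfl
  set ψ := iteratedDeriv m φ
  set K : ℝ := L + m + 1 with hK
  have hK0 : 0 < K := by positivity
  obtain ⟨δ, hδ0, hδ⟩ := Metric.uniformContinuousOn_iff.1
    ((isCompact_Icc (a := -K) (b := K)).uniformContinuousOn_of_continuous hcont.continuousOn)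
    (ε / 3) (by positivity)
  have hsmall : ∀ᶠ n : ℕ in atTop, ((M : ℝ) ^ n)⁻¹ < δ :=
    (tendsto_inv_atTop_zero.comp (tendsto_pow_atTop_atTop_of_one_lt hM1)).eventually
      (gt_mem_nhds hδ0)
  filter_upwards [hsmall, (isQSLimit_iff.1 hφ).2 m le_rfl K hK0 (ε / 3) (by positivity)]
    with n hn1 hn2 k
  have hMn : (1 : ℝ) ≤ (M : ℝ) ^ n := one_le_pow₀ hM1.le
  have hMn0 : (0 : ℝ) < (M : ℝ) ^ n := by linarith
  have hmem : ∀ l : ℤ, |(l : ℝ)| ≤ (M : ℝ) ^ n * K → (l : ℝ) / (M : ℝ) ^ n ∈ Set.Icc (-K) K := by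
    intro l hl
    rw [Set.mem_Icc, ← abs_le, abs_div, abs_of_pos hMn0, div_le_iff₀ hMn0]
    linarith
  have hout : ∀ l : ℤ, (M : ℝ) ^ n * K - 1 < |(l : ℝ)| → scaledDiff M a diracSeq m n l = 0 := by
    intro l hl
    refine supportedIn_scaledDiff hM hL0 hL m n l ?_
    have : ((L : ℝ) + m) * (M : ℝ) ^ n < |(l : ℝ)| := by nlinarith
    exact_mod_cast this
  have hk1 : |(k : ℝ)| ≤ |((k - 1 : ℤ) : ℝ)| + 1 := by
    push_cast
    simpa using abs_add_le ((k : ℝ) - 1) 1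
  have hk2 : |((k - 1 : ℤ) : ℝ)| ≤ |(k : ℝ)| + 1 := by
    push_cast
    simpa using abs_sub (k : ℝ) 1
  simp only [backwardDiff]
  by_cases h : |(k : ℝ)| ≤ (M : ℝ) ^ n * K ∧ |((k - 1 : ℤ) : ℝ)| ≤ (M : ℝ) ^ n * K
  · have e1 := hn2 k h.1
    have e2 := hn2 (k - 1) h.2
    have e3 := hδ _ (hmem k h.1) _ (hmem (k - 1) h.2) (by
      rw [Real.dist_eq, ← sub_div]
      push_cast
      rwa [sub_sub_cancel, abs_div, abs_one, abs_of_pos hMn0, one_div])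
    rw [dist_eq_norm] at e3
    set u := scaledDiff M a diracSeq m n k
    set v := scaledDiff M a diracSeq m n (k - 1)
    calc ‖u - v‖ = ‖(u - ψ ((k : ℝ) / (M : ℝ) ^ n)) +
          (ψ ((k : ℝ) / (M : ℝ) ^ n) - ψ (((k - 1 : ℤ) : ℝ) / (M : ℝ) ^ n)) -
          (v - ψ (((k - 1 : ℤ) : ℝ) / (M : ℝ) ^ n))‖ := by
          congr 1
          ring
      _ ≤ ε / 3 + ε / 3 + ε / 3 :=
          (norm_sub_le _ _).trans (add_le_add ((norm_add_le _ _).trans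
            (add_le_add e1.le e3.le)) e2.le)
      _ = ε := by ring
  · have hbig : (M : ℝ) ^ n * K < |(k : ℝ)| ∨ (M : ℝ) ^ n * K < |((k - 1 : ℤ) : ℝ)| := by
      by_contra! hcon
      exact h hcon
    rw [hout k (by rcases hbig with h | h <;> linarith),
      hout (k - 1) (by rcases hbig with h | h <;> linarith), sub_zero, norm_zero]
    exact hε.le

/-- Characterization of `C^m`-convergence by smoothness and sum rules. -/
theorem qsConvergent_iff (hM : 2 ≤ M) (ha : ∀ ℓ, (Function.support (a ℓ)).Finite)
    (hsum : ∀ ℓ, ∑ᶠ k : ℤ, a ℓ k = 1) (m : ℕ) :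
    QSConvergent M a m ↔
      (m : ℝ) < smInfty (M ^ r) (compositeMask M a) ∧ ∀ ℓ, m < sumRuleOrder M (a ℓ) := by
  have hD : 2 ≤ M ^ r := hM.trans (Nat.le_self_pow (NeZero.ne r) M)
  have hcfin := finite_support_compositeMask hM ha
  have hcsum := finsum_compositeMask hM ha hsum
  constructor
  · intro h
    obtain ⟨φ, hφ⟩ := h diracSeq
    obtain ⟨b, hb, hab⟩ := hφ.exists_eq_boxSum_iterate hM ha hsum le_rfl
    refine ⟨lt_smInfty_of_small hD hcfin hcsum (hasSumRules_compositeMask hM hb hab)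
      fun ε hε => ?_, fun ℓ => le_sumRuleOrder hM (ha ℓ) (ne_zero_of_finsum_eq_one (hsum ℓ))
        ((hasSumRules_iff (ha ℓ)).2 ⟨b ℓ, hb ℓ, hab ℓ⟩)⟩
    obtain ⟨n, hn⟩ := eventually_atTop.1 (hφ.eventually_backwardDiff_le hM ha hε)
    refine ⟨n + 1, Nat.succ_pos n, fun k => ?_⟩
    have h1 := hn (r * (n + 1)) ((Nat.le_succ n).trans
      (Nat.le_mul_of_pos_left _ (Nat.pos_of_neZero r))) k
    have h2 : backwardDiff (scaledDiff M a diracSeq m (r * (n + 1))) k =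
        (M : ℂ) ^ (m * (r * (n + 1))) * backwardDiff^[m + 1]
          (subdivSeq (M ^ r) (fun _ => compositeMask M a) (n + 1) diracSeq) k := by
      simp only [backwardDiff, scaledDiff, Function.iterate_succ_apply', quasiSubdiv_mul hM ha]
      ring
    rw [h2, norm_mul, norm_pow, Complex.norm_natCast] at h1
    push_cast
    rwa [← pow_mul, show r * (m * (n + 1)) = m * (r * (n + 1)) by ring]
  · rintro ⟨hsm, hsr⟩
    choose b hb hab using fun ℓ =>
      exists_eq_boxSum_iterate_of_le hM (ha ℓ) (ne_zero_of_finsum_eq_one (hsum ℓ)) (hsr ℓ)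
    have hcsr := le_sumRuleOrder hD hcfin (ne_zero_of_finsum_eq_one hcsum)
      (hasSumRules_compositeMask hM hb hab)
    obtain ⟨φ, hφ⟩ := exists_isQSLimit_diracSeq hM hsum hb hab
      (geometricDecay_of_lt_smInfty hD hcfin hcsum hsm hcsr)
    exact qsConvergent_of_diracSeq hM ha hφ

end Periodic

/-! ### Refinement, interpolation and the coset conditions -/

section Periodic

variable {M r : ℕ} [NeZero r] {a : Fin r → ℤ → ℂ}

/-- The refinement equation: passing to the data after `n` periods dilates the limit by
`M ^ (r n)`. -/
lemma IsQSLimit.eq_dilate (hM : 2 ≤ M) (ha : ∀ ℓ, (Function.support (a ℓ)).Finite) {m : ℕ}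
    {v : ℤ → ℂ} {η η' : ℝ → ℂ} (n : ℕ) (hη : IsQSLimit M a m v η)
    (hη' : IsQSLimit M a m (quasiSubdiv M a (r * n) v) η') (x : ℝ) :
    η x = η' ((M : ℝ) ^ (r * n) * x) := by
  have hM0 : M ≠ 0 := by omega
  have h1 := hη'.tendsto hM0 tendsto_id (tendsto_floor_div hM ((M : ℝ) ^ (r * n) * x))
  have hN : Tendsto (fun N => r * n + N) atTop atTop :=
    tendsto_atTop_mono (fun N => Nat.le_add_left N _) tendsto_id
  have h2 := hη.tendsto hM0 hN (k := fun N => ⌊(M : ℝ) ^ (r * n + N) * x⌋)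
    (tendsto_div_pow_of_abs_sub_le hM hN fun N => abs_floor_sub_le _)
  refine tendsto_nhds_unique h2 (h1.congr fun N => ?_)
  simp only [id]
  rw [quasiSubdiv_mul hM ha, ← quasiSubdiv_add_mul hM ha, ← mul_assoc, ← pow_add, add_comm N]

lemma IsQSLimit.refinement (hM : 2 ≤ M) (ha : ∀ ℓ, (Function.support (a ℓ)).Finite) {m : ℕ}
    (hconv : QSConvergent M a m) {φ : ℝ → ℂ} (hφ : IsQSLimit M a m diracSeq φ) (n : ℕ) (x : ℝ) :
    φ x = ∑ᶠ k : ℤ, quasiSubdiv M a (r * n) diracSeq k * φ ((M : ℝ) ^ (r * n) * x - k) := by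
  obtain ⟨L, hL0, hL⟩ := exists_supportedIn_of_fintype ha
  obtain ⟨η, hη⟩ := hconv (quasiSubdiv M a (r * n) diracSeq)
  rw [hφ.eq_dilate hM ha n hη, hφ.eq_finsum hM hL0 hL hη]

lemma quasiSubdiv_one (hM : 2 ≤ M) (ha : ∀ ℓ, (Function.support (a ℓ)).Finite)
    (hsum : ∀ ℓ, ∑ᶠ k : ℤ, a ℓ k = 1) (hsr : ∀ ℓ, 0 < sumRuleOrder M (a ℓ)) (n : ℕ) :
    quasiSubdiv M a n (fun _ => 1) = fun _ => 1 := by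
  have hM0 : M ≠ 0 := by omega
  induction n with
  | zero => rfl
  | succ n ih =>
    obtain ⟨b, hb, hab⟩ := exists_eq_boxSum_iterate_of_le (J := 0 + 1) hM (ha (Fin.ofNat r n))
      (ne_zero_of_finsum_eq_one (hsum _)) (hsr _)
    have h1 := hsum (Fin.ofNat r n)
    rw [hab] at h1
    funext j
    rw [quasiSubdiv, ih, hab, subdivOp]
    simpa using coset_sum_of_boxSum hM0 hb h1 j

/-- The integer translates of the basic limit function form a partition of unity. -/
lemma IsQSLimit.finsum_translates (hM : 2 ≤ M) (ha : ∀ ℓ, (Function.support (a ℓ)).Finite)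
    (hsum : ∀ ℓ, ∑ᶠ k : ℤ, a ℓ k = 1) {m : ℕ} (hconv : QSConvergent M a m) {φ : ℝ → ℂ}
    (hφ : IsQSLimit M a m diracSeq φ) (x : ℝ) : ∑ᶠ k : ℤ, φ (x + k) = 1 := by
  obtain ⟨L, hL0, hL⟩ := exists_supportedIn_of_fintype ha
  obtain ⟨η, hη⟩ := hconv fun _ => 1
  have hsr := fun ℓ => (Nat.zero_le m).trans_lt (((qsConvergent_iff hM ha hsum m).1 hconv).2 ℓ)
  have h1 := hη.tendsto (by omega) tendsto_id (tendsto_floor_div hM x)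
  simp only [quasiSubdiv_one hM ha hsum hsr] at h1
  have h2 := hφ.eq_finsum hM hL0 hL hη x
  rw [tendsto_nhds_unique h1 tendsto_const_nhds] at h2
  rw [h2, ← finsum_comp_equiv (Equiv.neg ℤ)]
  refine finsum_congr fun k => ?_
  simp [sub_eq_add_neg]

/-- Interpolation at `s + ℤ` only has to be checked on the basic limit function. -/
lemma qsInftyStepInterpolatory_iff (hM : 2 ≤ M) (ha : ∀ ℓ, (Function.support (a ℓ)).Finite)
    {m : ℕ} {φ : ℝ → ℂ} (hφ : IsQSLimit M a m diracSeq φ) {s : ℝ} :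
    QSInftyStepInterpolatory M a m s ↔ ∀ k : ℤ, φ (s + k) = diracSeq k := by
  refine ⟨fun h => h diracSeq φ hφ, fun h v η hη k => ?_⟩
  obtain ⟨L, hL0, hL⟩ := exists_supportedIn_of_fintype ha
  have e : ∀ l : ℤ, φ (s + k - l) = diracSeq (k - l) := fun l => by
    rw [← h]
    congr 1
    push_cast
    ring
  rw [hφ.eq_finsum hM hL0 hL hη]
  simp only [e]
  rw [finsum_eq_single _ k]
  · simp [diracSeq]
  · intro l hl
    have : k - l ≠ 0 := fun h0 => hl (by omega)
    simp [diracSeq, this]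

lemma iterMask_compositeMask (hM : 2 ≤ M) (ha : ∀ ℓ, (Function.support (a ℓ)).Finite) (n : ℕ)
    (k : ℤ) : iterMask (M ^ r) (compositeMask M a) n k =
      (((M ^ r : ℕ) : ℂ) ^ n)⁻¹ * quasiSubdiv M a (r * n) diracSeq k := by
  rw [iterMask, iterate_subdivOp_eq, quasiSubdiv_mul hM ha]

/-- The refinement equation in terms of the samples `φ(t + k)`. -/
lemma IsQSLimit.seqConv_iterMask (hM : 2 ≤ M) (ha : ∀ ℓ, (Function.support (a ℓ)).Finite) {m : ℕ}
    (hconv : QSConvergent M a m) {φ : ℝ → ℂ} (hφ : IsQSLimit M a m diracSeq φ) (n : ℕ) (t : ℝ)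
    (j : ℤ) :
    seqConv (iterMask (M ^ r) (compositeMask M a) n) (fun k => φ (t + k)) j =
      (((M ^ r : ℕ) : ℂ) ^ n)⁻¹ * φ ((t + j) / (M : ℝ) ^ (r * n)) := by
  have hM' : (M : ℝ) ^ (r * n) ≠ 0 := pow_ne_zero _ (by exact_mod_cast (by omega : M ≠ 0))
  have h := smul_finsum (((M ^ r : ℕ) : ℂ) ^ n)⁻¹ fun k : ℤ =>
    quasiSubdiv M a (r * n) diracSeq k *
      φ ((M : ℝ) ^ (r * n) * ((t + j) / (M : ℝ) ^ (r * n)) - k)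
  simp only [smul_eq_mul] at h
  rw [hφ.refinement hM ha hconv n, h, seqConv]
  refine finsum_congr fun k => ?_
  rw [iterMask_compositeMask hM ha, mul_div_cancel₀ _ hM', mul_assoc]
  congr 3
  push_cast
  ring

lemma IsQSLimit.finite_support_samples (hM : 2 ≤ M)
    (ha : ∀ ℓ, (Function.support (a ℓ)).Finite) {m : ℕ} {φ : ℝ → ℂ}
    (hφ : IsQSLimit M a m diracSeq φ) (t : ℝ) :
    (Function.support fun k : ℤ => φ (t + k)).Finite := by
  obtain ⟨L, hL0, hL⟩ := exists_supportedIn_of_fintype ha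
  refine SupportedIn.finite (L := L + ⌈|t|⌉) fun k hk => hφ.eq_zero hM hL0 hL ?_
  have h1 : (L : ℝ) + ⌈|t|⌉ < |(k : ℝ)| := by exact_mod_cast hk
  have h2 := Int.le_ceil |t|
  have h3 : |(k : ℝ)| ≤ |t + k| + |t| := by
    simpa using abs_sub (t + k) t
  linarith

/-- The samples `φ(M ^ (r p) s + k)` satisfy the coset conditions. -/
lemma IsQSLimit.cosetConditions (hM : 2 ≤ M) (ha : ∀ ℓ, (Function.support (a ℓ)).Finite) {m : ℕ}
    (hconv : QSConvergent M a m) {φ : ℝ → ℂ} (hφ : IsQSLimit M a m diracSeq φ) {s : ℝ}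
    (hint : ∀ k : ℤ, φ (s + k) = diracSeq k) {p n : ℕ} {c : ℤ}
    (hc : (M : ℝ) ^ (r * p) * ((M : ℝ) ^ (r * n) - 1) * s = c) :
    CosetConditions (M ^ r) (compositeMask M a) p n c fun k => φ ((M : ℝ) ^ (r * p) * s + k) := by
  constructor
  · intro k
    rw [hφ.seqConv_iterMask hM ha hconv, ← hint]
    congr 2
    push_cast
    rw [← pow_mul]
    field_simp
  · intro k
    rw [hφ.seqConv_iterMask hM ha hconv]
    congr 2
    push_cast
    rw [← hc, ← pow_mul]
    field_simp
    ring

/-- The second coset condition, iterated: convolution with `w` commutes with the passage from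
one scale to the next along the points `c + N k`. -/
lemma sum_quasiSubdiv_iterate (hM : 2 ≤ M) (ha : ∀ ℓ, (Function.support (a ℓ)).Finite) {n : ℕ}
    {c : ℤ} {w : ℤ → ℂ} {s : Finset ℤ}
    (h : ∀ k : ℤ, ∑ l ∈ s, w l * quasiSubdiv M a (r * n) diracSeq
      (c + (M : ℤ) ^ (r * n) * k - l) = w k) (hs : ∀ k, k ∉ s → w k = 0) (q : ℕ) (k : ℤ) :
    ∑ l ∈ s, w l * quasiSubdiv M a (r * (n * q)) diracSeq
      ((∑ i ∈ Finset.range q, (M : ℤ) ^ (i * (r * n))) * c + (M : ℤ) ^ (r * (n * q)) * k - l) =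
      w k := by
  induction q with
  | zero =>
    simp only [mul_zero, quasiSubdiv, diracSeq, Finset.range_zero, Finset.sum_empty, zero_mul,
      pow_zero, zero_add, one_mul, sub_eq_zero, mul_ite, mul_one]
    rw [Finset.sum_ite_eq]
    split_ifs with hk
    · rfl
    · exact (hs k hk).symm
  | succ q ih =>
    -- split off the last period block, apply the hypothesis at `C - i`, then the induction hypothesis
    set f := quasiSubdiv M a (r * (n * q)) diracSeq with hf
    have hffin : (Function.support f).Finite := by
      rw [hf, quasiSubdiv_eq]
      exact finite_support_subdivSeq hM (fun _ => ha _) supportedIn_diracSeq.finite _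
    have hsplit : ∀ j, quasiSubdiv M a (r * (n * (q + 1))) diracSeq j =
        ∑ i ∈ hffin.toFinset, f i *
          quasiSubdiv M a (r * n) diracSeq (j - (M : ℤ) ^ (r * n) * i) := by
      intro j
      rw [show r * (n * (q + 1)) = r * (n * q) + r * n by ring, quasiSubdiv_add_mul hM ha,
        ← quasiSubdiv_mul hM ha, ← hf, quasiSubdiv_eq, quasiSubdiv_eq,
        subdivSeq_eq_finsum hM (fun _ => ha _)]
      refine finsum_eq_sum_of_support_subset _ fun i hi => ?_
      simpa using left_ne_zero_of_mul hi
    set C : ℤ := (∑ i ∈ Finset.range q, (M : ℤ) ^ (i * (r * n))) * c + (M : ℤ) ^ (r * (n * q)) * k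
    have hC : (∑ i ∈ Finset.range (q + 1), (M : ℤ) ^ (i * (r * n))) * c +
        (M : ℤ) ^ (r * (n * (q + 1))) * k = c + (M : ℤ) ^ (r * n) * C := by
      simp only [C]
      rw [Finset.sum_range_succ', show r * (n * (q + 1)) = r * n + r * (n * q) by ring, pow_add]
      simp only [zero_mul, pow_zero, add_mul, one_mul, pow_add, mul_add]
      rw [← Finset.sum_mul]
      ring
    rw [hC]
    simp only [hsplit, Finset.mul_sum]
    rw [Finset.sum_comm]
    have e : ∀ i ∈ hffin.toFinset, ∑ l ∈ s, w l * (f i * quasiSubdiv M a (r * n) diracSeq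
        (c + (M : ℤ) ^ (r * n) * C - l - (M : ℤ) ^ (r * n) * i)) = f i * w (C - i) := by
      intro i _
      rw [← h (C - i), Finset.mul_sum]
      refine Finset.sum_congr rfl fun l _ => ?_
      rw [show c + (M : ℤ) ^ (r * n) * C - l - (M : ℤ) ^ (r * n) * i =
        c + (M : ℤ) ^ (r * n) * (C - i) - l by ring]
      ring
    rw [Finset.sum_congr rfl e, ← ih]
    have h1 : ∑ i ∈ hffin.toFinset, f i * w (C - i) = ∑ᶠ i, f i * w (C - i) := by
      rw [finsum_eq_sum_of_support_subset]
      intro i hi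
      simpa using left_ne_zero_of_mul hi
    have h2 : ∑ l ∈ s, w l * f (C - l) = ∑ᶠ l, w l * f (C - l) := by
      rw [finsum_eq_sum_of_support_subset]
      intro l hl
      by_contra hls
      exact left_ne_zero_of_mul hl (hs l hls)
    rw [h1, h2, ← finsum_comp_equiv (Equiv.subLeft C)]
    refine finsum_congr fun l => ?_
    simp only [Equiv.subLeft_apply, sub_sub_cancel]
    ring

lemma seqConv_comm (u v : ℤ → ℂ) (j : ℤ) : seqConv u v j = seqConv v u j := by
  rw [seqConv, seqConv, ← finsum_comp_equiv (Equiv.subLeft j)]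
  refine finsum_congr fun l => ?_
  simp only [Equiv.subLeft_apply, sub_sub_cancel]
  ring

lemma geom_sum_mul_eq {N : ℝ} {c t : ℝ} (hc : N * t = t + c) (q : ℕ) :
    (∑ i ∈ Finset.range q, N ^ i) * c = N ^ q * t - t := by
  rw [show c = (N - 1) * t by linarith, ← mul_assoc, geom_sum_mul]
  ring

/-- Conversely, a solution of the coset conditions consists of the samples of `φ`: iterating the
second condition and passing to the limit gives `w(k) = φ(t + k) ∑ w`, and the first condition
together with the partition of unity normalizes the sum. -/
lemma IsQSLimit.eq_diracSeq_of_cosetConditions (hM : 2 ≤ M)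
    (ha : ∀ ℓ, (Function.support (a ℓ)).Finite) (hsum : ∀ ℓ, ∑ᶠ k : ℤ, a ℓ k = 1) {m : ℕ}
    (hconv : QSConvergent M a m) {φ : ℝ → ℂ} (hφ : IsQSLimit M a m diracSeq φ) {s : ℝ}
    {p n : ℕ} (hn : 1 ≤ n) {c : ℤ} (hc : (M : ℝ) ^ (r * p) * ((M : ℝ) ^ (r * n) - 1) * s = c)
    {w : ℤ → ℂ} (hw : (Function.support w).Finite)
    (hcos : CosetConditions (M ^ r) (compositeMask M a) p n c w) (k : ℤ) :
    φ (s + k) = diracSeq k := by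
  have hM0 : M ≠ 0 := by omega
  set t : ℝ := (M : ℝ) ^ (r * p) * s with ht
  have hct : (M : ℝ) ^ (r * n) * t = t + c := by rw [← hc, ht]; ring
  obtain ⟨h1, h2⟩ := hcos
  have hstep : ∀ k : ℤ, ∑ l ∈ hw.toFinset, w l * quasiSubdiv M a (r * n) diracSeq
      (c + (M : ℤ) ^ (r * n) * k - l) = w k := by
    intro k
    have h3 := h2 k
    rw [seqConv_comm, seqConv, finsum_eq_sum_of_support_subset (s := hw.toFinset)] at h3
    · simp only [iterMask_compositeMask hM ha] at h3
      refine mul_left_cancel₀ (inv_ne_zero (pow_ne_zero n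
        (by exact_mod_cast pow_ne_zero r hM0 : ((M ^ r : ℕ) : ℂ) ≠ 0))) (Eq.trans ?_ h3)
      rw [Finset.mul_sum]
      refine Finset.sum_congr rfl fun l _ => ?_
      push_cast
      rw [← pow_mul (M : ℤ)]
      ring
    · intro l hl
      simpa using left_ne_zero_of_mul hl
  set σ := ∑ l ∈ hw.toFinset, w l
  have hsamp : ∀ k : ℤ, w k = σ * φ (t + k) := by
    intro k
    have hN : Tendsto (fun q => r * (n * q)) atTop atTop :=
      tendsto_atTop_mono (fun q => by
        have h3 : q ≤ n * q := Nat.le_mul_of_pos_left q hn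
        exact h3.trans (Nat.le_mul_of_pos_left _ (Nat.pos_of_neZero r))) tendsto_id
    -- the accumulated shift is `(M ^ (r n q) - 1) t`, so the arguments differ from
    -- `M ^ (r n q) (t + k)` by the constant `-t - l`
    have hlim : ∀ l : ℤ, Tendsto (fun q => quasiSubdiv M a (r * (n * q)) diracSeq
        ((∑ i ∈ Finset.range q, (M : ℤ) ^ (i * (r * n))) * c + (M : ℤ) ^ (r * (n * q)) * k - l))
        atTop (𝓝 (φ (t + k))) := by
      intro l
      refine hφ.tendsto hM0 hN (tendsto_div_pow_of_abs_sub_le hM hN (C := |-t - l|)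
        fun q => le_of_eq ?_)
      have h4 := geom_sum_mul_eq hct q
      simp only [← pow_mul] at h4
      congr 1
      push_cast
      simp only [mul_comm _ (r * n)]
      rw [h4, mul_assoc r n q]
      ring
    have h5 := tendsto_finsetSum hw.toFinset fun l _ => (hlim l).const_mul (w l)
    rw [← Finset.sum_mul] at h5
    refine tendsto_nhds_unique (tendsto_const_nhds.congr fun q => ?_) h5
    exact (sum_quasiSubdiv_iterate hM ha hstep (fun l hl => by simpa using hl) q k).symm
  have hprod : ∀ k : ℤ, σ * φ (s + k) = diracSeq k := by
    intro k
    have h3 := h1 k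
    rw [show w = fun k : ℤ => σ * φ (t + k) from funext hsamp] at h3
    have h4 := smul_finsum σ fun l : ℤ => iterMask (M ^ r) (compositeMask M a) p l *
      φ (t + (((M ^ r : ℕ) : ℤ) ^ p * k - l : ℤ))
    simp only [smul_eq_mul] at h4
    have h5 := hφ.seqConv_iterMask hM ha hconv p t (((M ^ r : ℕ) : ℤ) ^ p * k)
    rw [seqConv] at h3 h5
    rw [h5] at h4
    rw [finsum_congr fun l => mul_left_comm _ σ _, ← h4] at h3
    refine mul_left_cancel₀ (inv_ne_zero (pow_ne_zero p
      (by exact_mod_cast pow_ne_zero r hM0 : ((M ^ r : ℕ) : ℂ) ≠ 0))) (Eq.trans ?_ h3)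
    rw [mul_left_comm]
    congr 3
    push_cast
    rw [ht, ← pow_mul]
    field_simp
  -- the partition of unity, summed against `σ φ(s + k) = δ(k)`
  have hσ1 : σ = 1 := by
    have h3 := smul_finsum σ fun k : ℤ => φ (s + k)
    simp only [smul_eq_mul, hprod] at h3
    rw [hφ.finsum_translates hM ha hsum hconv, mul_one] at h3
    rw [h3, finsum_eq_single _ 0 fun k hk => by simp [diracSeq, hk]]
    simp [diracSeq]
  rw [← hprod, hσ1, one_mul]

lemma seqConv_diracSeq (u : ℤ → ℂ) (j : ℤ) : seqConv u diracSeq j = u j := by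
  rw [seqConv, finsum_eq_single _ j]
  · simp [diracSeq]
  · intro k hk
    have : j - k ≠ 0 := fun h => hk (by omega)
    simp [diracSeq, this]

/-- Without a preliminary scale (`p = 0`), the first coset condition forces `w = δ`. -/
lemma exists_cosetConditions_zero_iff (D : ℕ) (a : ℤ → ℂ) (n : ℕ) (c : ℤ) :
    (∃ w : ℤ → ℂ, (Function.support w).Finite ∧ CosetConditions D a 0 n c w) ↔
      ∀ k : ℤ, iterMask D a n (c + (D : ℤ) ^ n * k) = ((D : ℂ) ^ n)⁻¹ * diracSeq k := by
  have h0 : iterMask D a 0 = diracSeq := by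
    funext k
    simp [iterMask]
  simp only [CosetConditions, h0, pow_zero, one_mul, inv_one]
  constructor
  · rintro ⟨w, -, h1, h2⟩ k
    have hw : w = diracSeq := funext fun k => by
      rw [← h1 k, seqConv_comm, seqConv_diracSeq]
    have h3 := h2 k
    rwa [hw, seqConv_diracSeq] at h3
  · intro h
    refine ⟨diracSeq, supportedIn_diracSeq.finite, fun k => seqConv_diracSeq _ k, fun k => ?_⟩
    rw [seqConv_diracSeq, h]

/-- If `S^{r n, r}` reproduces the data on the points `c + M ^ (r n) k`, then so do its powers,
with the accumulated shifts. -/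
lemma quasiSubdiv_interpolates (hM : 2 ≤ M) (ha : ∀ ℓ, (Function.support (a ℓ)).Finite) {n : ℕ}
    {c : ℤ} (h : ∀ k : ℤ, quasiSubdiv M a (r * n) diracSeq (c + (M : ℤ) ^ (r * n) * k) =
      diracSeq k) (q : ℕ) (v : ℤ → ℂ) (k : ℤ) :
    quasiSubdiv M a (q * r * n) v
      ((∑ i ∈ Finset.range q, (M : ℤ) ^ (i * (r * n))) * c + (M : ℤ) ^ (q * r * n) * k) = v k := by
  have hone : ∀ (v : ℤ → ℂ) (k : ℤ),
      quasiSubdiv M a (r * n) v (c + (M : ℤ) ^ (r * n) * k) = v k := by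
    intro v k
    rw [quasiSubdiv_eq, subdivSeq_eq_finsum hM (fun _ => ha _)]
    simp only [← quasiSubdiv_eq]
    have e : ∀ l : ℤ, quasiSubdiv M a (r * n) diracSeq
        (c + (M : ℤ) ^ (r * n) * k - (M : ℤ) ^ (r * n) * l) = diracSeq (k - l) := fun l => by
      rw [← h]
      congr 1
      ring
    simp only [e]
    exact seqConv_diracSeq v k
  induction q with
  | zero => simp [quasiSubdiv]
  | succ q ih =>
    have hC : (∑ i ∈ Finset.range (q + 1), (M : ℤ) ^ (i * (r * n))) * c +
        (M : ℤ) ^ ((q + 1) * r * n) * k = c + (M : ℤ) ^ (r * n) *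
          ((∑ i ∈ Finset.range q, (M : ℤ) ^ (i * (r * n))) * c + (M : ℤ) ^ (q * r * n) * k) := by
      rw [Finset.sum_range_succ', show (q + 1) * r * n = r * n + q * r * n by ring, pow_add]
      simp only [zero_mul, pow_zero, add_mul, one_mul, pow_add, mul_add]
      rw [← Finset.sum_mul]
      ring
    rw [hC, show (q + 1) * r * n = r * (q * n) + r * n by ring, quasiSubdiv_add_mul hM ha,
      ← quasiSubdiv_mul hM ha, hone, show r * (q * n) = q * r * n by ring, ih]

end Periodic

theorem corollary4p1 (M : ℕ) (hM : 2 ≤ M) (r : ℕ) [NeZero r] (m : ℕ)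
    (a : Fin r → ℤ → ℂ) (ha : ∀ ℓ, (Function.support (a ℓ)).Finite)
    (hsum : ∀ ℓ, ∑ᶠ k : ℤ, a ℓ k = 1)
    (ms ns : ℕ) (hns : 1 ≤ ns) (s : ℝ) (c : ℤ)
    (hc : (M : ℝ) ^ (r * ms) * ((M : ℝ) ^ (r * ns) - 1) * s = c) :
    ((QSConvergent M a m ∧ QSInftyStepInterpolatory M a m s) ↔
      (((m : ℝ) < smInfty (M ^ r) (compositeMask M a) ∧ ∀ ℓ, m < sumRuleOrder M (a ℓ)) ∧
        ∃ w : ℤ → ℂ, (Function.support w).Finite ∧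
          CosetConditions (M ^ r) (compositeMask M a) ms ns c w)) ∧
    (ms = 0 →
      ((∃ w : ℤ → ℂ, (Function.support w).Finite ∧
          CosetConditions (M ^ r) (compositeMask M a) ms ns c w) ↔
        ∀ k : ℤ, iterMask (M ^ r) (compositeMask M a) ns (c + (M : ℤ) ^ (r * ns) * k) =
          ((M : ℂ) ^ (r * ns))⁻¹ * diracSeq k)) ∧
    (ms = 0 → QSConvergent M a m → QSInftyStepInterpolatory M a m s →
      ∀ q : ℕ, 1 ≤ q → ∀ (v : ℤ → ℂ) (k : ℤ),
        quasiSubdiv M a (q * r * ns) v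
          ((∑ i ∈ Finset.range q, (M : ℤ) ^ (i * (r * ns))) * c + (M : ℤ) ^ (q * r * ns) * k)
          = v k) := by
  have hMC : (M : ℂ) ≠ 0 := by exact_mod_cast (by omega : M ≠ 0)
  have hcoset : QSConvergent M a m → QSInftyStepInterpolatory M a m s →
      ∃ w : ℤ → ℂ, (Function.support w).Finite ∧
        CosetConditions (M ^ r) (compositeMask M a) ms ns c w := by
    intro hconv hint
    obtain ⟨φ, hφ⟩ := hconv diracSeq
    exact ⟨_, hφ.finite_support_samples hM ha _, hφ.cosetConditions hM ha hconv
      ((qsInftyStepInterpolatory_iff hM ha hφ).1 hint) hc⟩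
  have hzero : ms = 0 →
      ((∃ w : ℤ → ℂ, (Function.support w).Finite ∧
          CosetConditions (M ^ r) (compositeMask M a) ms ns c w) ↔
        ∀ k : ℤ, iterMask (M ^ r) (compositeMask M a) ns (c + (M : ℤ) ^ (r * ns) * k) =
          ((M : ℂ) ^ (r * ns))⁻¹ * diracSeq k) := by
    rintro rfl
    have h := exists_cosetConditions_zero_iff (M ^ r) (compositeMask M a) ns c
    push_cast at h
    simp only [← pow_mul] at h
    exact h
  refine ⟨?_, hzero, ?_⟩
  · rw [← qsConvergent_iff hM ha hsum m]
    refine ⟨fun ⟨hconv, hint⟩ => ⟨hconv, hcoset hconv hint⟩, ?_⟩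
    rintro ⟨hconv, w, hw, hcos⟩
    obtain ⟨φ, hφ⟩ := hconv diracSeq
    exact ⟨hconv, (qsInftyStepInterpolatory_iff hM ha hφ).2
      (hφ.eq_diracSeq_of_cosetConditions hM ha hsum hconv hns hc hw hcos)⟩
  · intro hms hconv hint q _ v k
    refine quasiSubdiv_interpolates hM ha (fun k => ?_) q v k
    have h := (hzero hms).1 (hcoset hconv hint) k
    rw [iterMask_compositeMask hM ha] at h
    push_cast at h
    rw [← pow_mul] at h
    exact mul_left_cancel₀ (inv_ne_zero (pow_ne_zero _ hMC)) h
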